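/- Curves are maps $\gamma:[0,1]\to\mathbb{R}^2$ of class $H^2$ (continuous representative); $\gamma$ is regular if $\gamma_x\neq 0$ on $[0,1]$. For regular $\gamma$ put $\partial_s=|\gamma_x|^{-1}\partial_x$, $\mathrm{d}s=|\gamma_x|\,\mathrm{d}x$, $\tau=\partial_s\gamma$, let $\nu$ be the anticlockwise rotation of $\tau$ by $\pi/2$, define $k$ by $\partial_s^2\gamma=k\nu$, and let $L(\gamma)=\int_0^1|\gamma_x|\,\mathrm{d}x$. A $3$-network of class $H^2$ is a triple $\Gamma=\{\gamma^1,\gamma^2,\gamma^3\}$ of curves of class $H^2$ with $\gamma^1(x)=\gamma^2(x)=\gamma^3(x)$ for $x\in\{0,1\}$; its regular curves are parametrized with constant speed $|\gamma^i_x|\equiv L(\gamma^i)$. It is a Theta-network if all three curves are regular and, at $x=0$ and at $x=1$, the tangents $\tau^1,\tau^2,\tau^3$ form pairwise angles of $120$ degrees. It is a degenerate Theta-network if, up to relabelling, $\gamma^1,\gamma^2$ are regular, $L(\gamma^3)=0$, and $\gamma^1,\gamma^2$ form at the common end point angles in pairs of $120$ and $60$ degrees, that is, $\tau^1(0)$ and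 $\tau^2(0)$ form an angle of $120$ degrees and $(\tau^1(1),\tau^2(1))$ equals $(\tau^1(0),\tau^2(0))$ or $(\tau^2(0),\tau^1(0))$. Define $$\overline F(\Gamma)=\sum_{i}\Big(\frac{1}{L^3(\gamma^i)}\int_0^1|\gamma^i_{xx}|^2\,\mathrm{d}x+L(\gamma^i)\Big),$$ with the sum over the three curves if $\Gamma$ is a Theta-network and over the two regular curves if $\Gamma$ is a degenerate Theta-network, and $\overline F(\Gamma)=+\infty$ otherwise. **Proposition.** Let $\widetilde\Gamma$ be a minimizer of $\overline F$ among all $3$-networks of class $H^2$ and let $\widetilde\gamma$ be any of the regular curves constituting $\widetilde\Gamma$. Then: 1. $\widetilde\gamma$ minimizes the penalized elastic energy $\int_\gamma (k^2+1)\,\mathrm{d}s$ among all regular $H^2$ curves $\gamma:[0,1]\to\mathbb{R}^2$ (of arbitrary speed) satisfying the same boundary conditions as $\widetilde\gamma$, i.e. $\gamma(x)=\widetilde\gamma(x)$ and $\partial_s\gamma(x)=\partial_s\widetilde\gamma(x)$ for $x\in\{0,1\}$. 2. $\widetilde\gamma\in C^\infty([0,1])$, and it solves $2\,\partial_s^2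 k+k^3-k=0$ on $(0,1)$. -/

import Mathlib

open Set MeasureTheory
open scoped ContDiff

noncomputable section

namespace ElasticNetwork

/-- The Euclidean plane. Curves are maps on the parameter interval `[0,1]`; they are represented by
functions on `ℝ` of which only the values on `[0,1]` are ever used. -/
abbrev Plane : Type := EuclideanSpace ℝ (Fin 2)

/-- `g` is a weak derivative of `f` on the open interval `(0,1)`. -/
def IsWeakDeriv (f g : ℝ → Plane) : Prop :=
  ∀ φ : ℝ → ℝ, ContDiff ℝ ∞ φ → HasCompactSupport φ → tsupport φ ⊆ Ioo 0 1 →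
    ∫ x in Ioo (0 : ℝ) 1, deriv φ x • f x = -∫ x in Ioo (0 : ℝ) 1, φ x • g x

/-- `f` is square integrable on `(0,1)`. -/
def IsL2 (f : ℝ → Plane) : Prop :=
  MemLp f 2 (volume.restrict (Ioo (0 : ℝ) 1))

/-- `γ : [0,1] → ℝ²` is of class `H²`: it has weak first and second derivatives in `L²(0,1)`, and
`γ` is the representative that is continuous on `[0,1]` (automatically `C¹` on `[0,1]`). -/
def IsH2 (γ : ℝ → Plane) : Prop :=
  ContinuousOn γ (Icc 0 1) ∧ IsL2 γ ∧
    ∃ g₁ g₂ : ℝ → Plane, IsL2 g₁ ∧ IsL2 g₂ ∧ IsWeakDeriv γ g₁ ∧ IsWeakDeriv g₁ g₂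

/-- Derivative with respect to the parameter in `[0,1]`, one-sided at the end points. -/
def dX {V : Type*} [NormedAddCommGroup V] [NormedSpace ℝ V] (f : ℝ → V) (x : ℝ) : V :=
  derivWithin f (Icc 0 1) x

/-- A curve (of class `C¹`) is regular if its velocity vanishes nowhere on `[0,1]`. -/
def IsRegularCurve (γ : ℝ → Plane) : Prop :=
  ∀ x ∈ Icc (0 : ℝ) 1, dX γ x ≠ 0

/-- The arclength derivative `∂ₛ = ∂ₓ / |∂ₓ γ|` along the curve `γ`. -/
def dS {V : Type*} [NormedAddCommGroup V] [NormedSpace ℝ V] (γ : ℝ → Plane) (f : ℝ → V) (x : ℝ) :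
    V :=
  ‖dX γ x‖⁻¹ • dX f x

/-- The unit tangent `τ = ∂ₛ γ`. -/
def tangent (γ : ℝ → Plane) : ℝ → Plane :=
  dS γ γ

/-- The unit normal `ν`: the anticlockwise rotation of `τ` by `π / 2`. -/
def normal (γ : ℝ → Plane) (x : ℝ) : Plane :=
  !₂[-(tangent γ x 1), tangent γ x 0]

/-- The scalar curvature `k`, determined by `∂ₛ² γ = k ν`. For a regular curve of class `H²` the
tangent is absolutely continuous, so that `k` is given by this formula almost everywhere. -/
def curvature (γ : ℝ → Plane) (x : ℝ) : ℝ :=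
  inner ℝ (dS γ (tangent γ) x) (normal γ x)

/-- The length of a curve. -/
def arcLength (γ : ℝ → Plane) : ℝ :=
  ∫ x in (0 : ℝ)..1, ‖dX γ x‖

/-- The penalized elastic energy `∫_γ (k² + 1) ds`, where `ds = |∂ₓ γ| dx`. For a regular curve of
class `H²` the integrand is integrable. -/
def elasticEnergy (γ : ℝ → Plane) : ℝ :=
  ∫ x in (0 : ℝ)..1, (curvature γ x ^ 2 + 1) * ‖dX γ x‖

/-- The penalized elastic energy written for a regular curve of constant speed,
`(1 / L³) ∫ |γ_xx|² dx + L`. -/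
def constSpeedEnergy (γ : ℝ → Plane) : ℝ :=
  1 / arcLength γ ^ 3 * (∫ x in (0 : ℝ)..1, ‖dX (dX γ) x‖ ^ 2) + arcLength γ

/-- A `3`-network of class `H²`: three curves of class `H²`, each running from the junction
`γⁱ(0) = P¹` to the junction `γⁱ(1) = P²`. The curves need not be regular, and may have length
zero; the regular ones are parametrized with constant speed equal to their length. -/
structure ThreeNetwork where
  curve : Fin 3 → ℝ → Plane
  isH2 : ∀ i, IsH2 (curve i)
  start_eq : ∀ i j, curve i 0 = curve j 0
  end_eq : ∀ i j, curve i 1 = curve j 1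
  const_speed : ∀ i, IsRegularCurve (curve i) →
    ∀ x ∈ Icc (0 : ℝ) 1, ‖dX (curve i) x‖ = arcLength (curve i)

/-- A Theta-network: the three curves are regular and meet at both junctions with angles of
`120` degrees. -/
def ThreeNetwork.IsTheta (Γ : ThreeNetwork) : Prop :=
  (∀ i, IsRegularCurve (Γ.curve i)) ∧
    ∀ i j, i ≠ j → ∀ x ∈ ({0, 1} : Set ℝ),
      InnerProductGeometry.angle (tangent (Γ.curve i) x) (tangent (Γ.curve j) x) =
        2 * Real.pi / 3

/-- A degenerate Theta-network: one curve (here number `l`) has length zero and the other two are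
regular, forming angles in pairs of `120` and `60` degrees at the common point `P¹ = P²`. That is,
the four half-tangents `τⁱ(0), τʲ(0), -τⁱ(1), -τʲ(1)` are `v, w, -v, -w` in some order, where `v`
and `w` are the half-tangents at the parameter `0` and form an angle of `120` degrees (and then so
do the half-tangents `-v` and `-w` at the parameter `1`). -/
def ThreeNetwork.IsDegenerateTheta (Γ : ThreeNetwork) : Prop :=
  ∃ i j l : Fin 3, i ≠ j ∧ i ≠ l ∧ j ≠ l ∧
    IsRegularCurve (Γ.curve i) ∧ IsRegularCurve (Γ.curve j) ∧ arcLength (Γ.curve l) = 0 ∧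
    InnerProductGeometry.angle (tangent (Γ.curve i) 0) (tangent (Γ.curve j) 0) =
      2 * Real.pi / 3 ∧
    ((tangent (Γ.curve i) 1 = tangent (Γ.curve i) 0 ∧
        tangent (Γ.curve j) 1 = tangent (Γ.curve j) 0) ∨
      (tangent (Γ.curve i) 1 = tangent (Γ.curve j) 0 ∧
        tangent (Γ.curve j) 1 = tangent (Γ.curve i) 0))

open Classical in
/-- The extended energy on `3`-networks of class `H²`: the sum of the energies of the three curves
of a Theta-network, the sum of the energies of the two regular curves of a degenerate
Theta-network, and `+∞` otherwise. -/
def ThreeNetwork.energyBar (Γ : ThreeNetwork) : EReal :=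
  if Γ.IsTheta then ((∑ i, constSpeedEnergy (Γ.curve i) : ℝ) : EReal)
  else if Γ.IsDegenerateTheta then
    ((∑ i with IsRegularCurve (Γ.curve i), constSpeedEnergy (Γ.curve i) : ℝ) : EReal)
  else ⊤

/-- `Γ` minimizes the extended energy among all `3`-networks of class `H²`. -/
def ThreeNetwork.IsMinimizer (Γ : ThreeNetwork) : Prop :=
  ∀ Γ' : ThreeNetwork, Γ.energyBar ≤ Γ'.energyBar

/-- `γ` and `γ'` have the same clamped boundary conditions: the same end points and the same unit
tangents there. -/
def SameBoundary (γ γ' : ℝ → Plane) : Prop :=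
  ∀ x ∈ ({0, 1} : Set ℝ), γ x = γ' x ∧ tangent γ x = tangent γ' x

end ElasticNetwork

end

open ElasticNetwork

/-!
A curve of class `H²` is differentiable on `[0,1]`, with an absolutely continuous derivative `v` whose
almost everywhere derivative `w` is square integrable (`IsH2.exists_hasH2Derivs`, which rests on the
du Bois-Reymond lemma, and conversely `HasH2Derivs.isH2`). In these terms `k = ⟨w, Jv⟩ / |v|³`
almost everywhere, `J` being the rotation by `π / 2`.

*Minimality of the single curves.* A regular curve of class `H²` has a reparametrization of constant
speed, again of class `H²`, with the same boundary conditions and the same elastic energy, which is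
now given by the constant speed formula (`HasH2Derivs.exists_constSpeed`). Hence every admissible
competitor of a regular curve of the network can be inserted into the network; tangents at the
junctions, regularity and vanishing lengths are unchanged, so the type of the network (Theta or
degenerate Theta) is too, and minimality of the network gives minimality of the curve
(`ThreeNetwork.IsMinimizer.elasticEnergy_le`). Two circles meeting at a point at an angle of `120`
degrees show that the minimal energy is finite (`isDegenerateTheta_twoCircles`); without this, a
minimizer could be a network of infinite energy.

*Regularity.* For a curve of constant speed `L` the elastic energy agrees with
`∫ (|γ''|² / |γ'|³ + |γ'|)`, and for all regular curves it is at most this integral. So the curve is a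
critical point of the latter for variations `γ + t φ e` (`HasH2Derivs.firstVariation_eq_zero`), that
is, `((2 / L³) γ'')'' = ((1 / L - 3 |γ''|² / L⁵) γ')'` in the sense of distributions. Integrating
once gives a vector `c` with `(2 / L³) γ''' = (1 / L - 3 |γ''|² / L⁵) γ' - c`. This is a first order
system for `(γ', γ'')` with smooth right-hand side, so `γ` is smooth up to the boundary
(`contDiffOn_infty_of_system`). Its normal component reads `k' = -⟨c, Jγ'⟩ / 2`, whence
`k'' = -⟨c, Jγ''⟩ / 2`; its tangential component, together with `|γ'| = L`, reads
`⟨c, γ'⟩ = L (1 - k²)`. As `Jγ'' = -k L γ'`, these two combine to the equation for the curvature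
(`HasH2Derivs.curvature_equation`).
-/

namespace ElasticNetwork

open Filter Topology
open scoped NNReal

/-! ### Absolutely continuous functions with values in the plane -/

/-- Postcomposition with a Lipschitz map preserves absolute continuity. -/
theorem _root_.AbsolutelyContinuousOnInterval.lipschitzOnWith_comp {X Y : Type*}
    [PseudoMetricSpace X] [PseudoMetricSpace Y] {f : ℝ → X} {Φ : X → Y} {K : ℝ≥0} {s : Set X}
    {a b : ℝ} (hf : AbsolutelyContinuousOnInterval f a b) (hΦ : LipschitzOnWith K Φ s)
    (hs : MapsTo f (uIcc a b) s) : AbsolutelyContinuousOnInterval (fun x ↦ Φ (f x)) a b := by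
  rw [absolutelyContinuousOnInterval_iff] at hf ⊢
  intro ε hε
  obtain ⟨δ, hδ, h⟩ := hf (ε / (K + 1)) (by positivity)
  refine ⟨δ, hδ, fun E hE hlen ↦ ?_⟩
  calc
    _ ≤ ∑ i ∈ Finset.range E.1, K * dist (f (E.2 i).1) (f (E.2 i).2) := by
      refine Finset.sum_le_sum fun i hi ↦ ?_
      exact hΦ.dist_le_mul _ (hs (hE.1 i hi).1) _ (hs (hE.1 i hi).2)
    _ = K * ∑ i ∈ Finset.range E.1, dist (f (E.2 i).1) (f (E.2 i).2) := by
      rw [Finset.mul_sum]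
    _ ≤ K * (ε / (K + 1)) := by gcongr; exact (h E hE hlen).le
    _ < (K + 1) * (ε / (K + 1)) := by gcongr; linarith
    _ = ε := by field

/-- Precomposition with a monotone Lipschitz change of parameter preserves absolute continuity;
monotonicity keeps disjoint intervals disjoint. -/
theorem _root_.AbsolutelyContinuousOnInterval.comp_monotoneOn_lipschitzOnWith {X : Type*}
    [PseudoMetricSpace X] {f : ℝ → X} {ψ : ℝ → ℝ} {K : ℝ≥0} {a b c d : ℝ}
    (hf : AbsolutelyContinuousOnInterval f c d) (hψ : LipschitzOnWith K ψ (uIcc a b))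
    (hmono : MonotoneOn ψ (uIcc a b)) (hmaps : MapsTo ψ (uIcc a b) (uIcc c d)) :
    AbsolutelyContinuousOnInterval (fun x ↦ f (ψ x)) a b := by
  rw [absolutelyContinuousOnInterval_iff] at hf ⊢
  intro ε hε
  obtain ⟨δ, hδ, h⟩ := hf ε hε
  refine ⟨δ / (K + 1), by positivity, fun E hE hlen ↦ ?_⟩
  refine h (E.1, fun i ↦ (ψ (E.2 i).1, ψ (E.2 i).2)) ⟨fun i hi ↦ ?_, fun i hi j hj hij ↦ ?_⟩ ?_
  · exact ⟨hmaps (hE.1 i hi).1, hmaps (hE.1 i hi).2⟩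
  · have hd := hE.2 hi hj hij
    have mi := hE.1 i hi
    have mj := hE.1 j hj
    have hmin {p q : ℝ} (hp : p ∈ uIcc a b) (hq : q ∈ uIcc a b) :
        min (ψ p) (ψ q) = ψ (min p q) := (hmono.map_min hp hq).symm
    have hmax {p q : ℝ} (hp : p ∈ uIcc a b) (hq : q ∈ uIcc a b) :
        max (ψ p) (ψ q) = ψ (max p q) := (hmono.map_max hp hq).symm
    have memmin {p q : ℝ} (hp : p ∈ uIcc a b) (hq : q ∈ uIcc a b) : min p q ∈ uIcc a b := by
      rcases min_choice p q with h | h <;> rwa [h]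
    have memmax {p q : ℝ} (hp : p ∈ uIcc a b) (hq : q ∈ uIcc a b) : max p q ∈ uIcc a b := by
      rcases max_choice p q with h | h <;> rwa [h]
    simp only [Function.onFun, uIoc, Ioc_disjoint_Ioc] at hd ⊢
    rw [hmin mi.1 mi.2, hmin mj.1 mj.2, hmax mi.1 mi.2, hmax mj.1 mj.2,
      hmax (memmin mi.1 mi.2) (memmin mj.1 mj.2), hmin (memmax mi.1 mi.2) (memmax mj.1 mj.2)]
    exact hmono (memmin (memmax mi.1 mi.2) (memmax mj.1 mj.2))
      (memmax (memmin mi.1 mi.2) (memmin mj.1 mj.2)) hd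
  · calc
      _ ≤ ∑ i ∈ Finset.range E.1, K * dist (E.2 i).1 (E.2 i).2 := by
        refine Finset.sum_le_sum fun i hi ↦ ?_
        exact hψ.dist_le_mul _ (hE.1 i hi).1 _ (hE.1 i hi).2
      _ = K * ∑ i ∈ Finset.range E.1, dist (E.2 i).1 (E.2 i).2 := by rw [Finset.mul_sum]
      _ ≤ K * (δ / (K + 1)) := by gcongr
      _ < (K + 1) * (δ / (K + 1)) := by gcongr; linarith
      _ = δ := by field

theorem _root_.AbsolutelyContinuousOnInterval.congr_uIcc {X : Type*} [PseudoMetricSpace X]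
    {f g : ℝ → X} {a b : ℝ} (hf : AbsolutelyContinuousOnInterval f a b)
    (hfg : EqOn f g (uIcc a b)) : AbsolutelyContinuousOnInterval g a b := by
  rw [absolutelyContinuousOnInterval_iff] at hf ⊢
  intro ε hε
  obtain ⟨δ, hδ, h⟩ := hf ε hε
  refine ⟨δ, hδ, fun E hE hlen ↦ ?_⟩
  rw [Finset.sum_congr rfl fun i hi ↦ by
    rw [← hfg (hE.1 i hi).1, ← hfg (hE.1 i hi).2]]
  exact h E hE hlen

theorem plane_eq_smul_add_smul (p : Plane) :
    p = p 0 • (!₂[1, 0] : Plane) + p 1 • (!₂[0, 1] : Plane) := by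
  ext i
  fin_cases i <;> simp

theorem absolutelyContinuousOnInterval_coord {f : ℝ → Plane} {a b : ℝ}
    (hf : AbsolutelyContinuousOnInterval f a b) (i : Fin 2) :
    AbsolutelyContinuousOnInterval (fun x ↦ f x i) a b :=
  hf.lipschitzOnWith_comp (Φ := fun p : Plane ↦ p i) (s := univ)
    ((EuclideanSpace.proj (𝕜 := ℝ) i : Plane →L[ℝ] ℝ).lipschitz.lipschitzOnWith)
    (mapsTo_univ _ _)

theorem absolutelyContinuousOnInterval_of_coord {f : ℝ → Plane} {a b : ℝ}
    (hf : ∀ i, AbsolutelyContinuousOnInterval (fun x ↦ f x i) a b) :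
    AbsolutelyContinuousOnInterval f a b := by
  have hc (p : Plane) : AbsolutelyContinuousOnInterval (fun _ : ℝ ↦ p) a b :=
    (contDiffOn_const (n := 1)).absolutelyContinuousOnInterval
  have h := ((hf 0).smul (hc !₂[1, 0])).add ((hf 1).smul (hc !₂[0, 1]))
  have he : f = ((fun x ↦ f x 0) • fun _ ↦ (!₂[1, 0] : Plane)) +
      (fun x ↦ f x 1) • fun _ ↦ (!₂[0, 1] : Plane) := funext fun x ↦ plane_eq_smul_add_smul (f x)
  rw [he]
  exact h

theorem hasDerivAt_coord {f : ℝ → Plane} {f' : Plane} {x : ℝ} (hf : HasDerivAt f f' x)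
    (i : Fin 2) : HasDerivAt (fun x ↦ f x i) (f' i) x :=
  (EuclideanSpace.proj (𝕜 := ℝ) i : Plane →L[ℝ] ℝ).hasFDerivAt.comp_hasDerivAt x hf

theorem intervalIntegrable_coord_iff {g : ℝ → Plane} {a b : ℝ} :
    IntervalIntegrable g volume a b ↔
      ∀ i, IntervalIntegrable (fun x ↦ g x i) volume a b := by
  constructor
  · intro h i
    rw [intervalIntegrable_iff] at h ⊢
    exact (EuclideanSpace.proj (𝕜 := ℝ) i : Plane →L[ℝ] ℝ).integrable_comp h
  · intro h
    simp only [intervalIntegrable_iff] at h ⊢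
    refine (((h 0).integrable.smul_const (!₂[1, 0] : Plane)).add
      ((h 1).integrable.smul_const (!₂[0, 1] : Plane))).congr (.of_forall fun x ↦ ?_)
    exact (plane_eq_smul_add_smul (g x)).symm

theorem intervalIntegral_coord {g : ℝ → Plane} {a b : ℝ} (hg : IntervalIntegrable g volume a b)
    (i : Fin 2) : (∫ x in a..b, g x) i = ∫ x in a..b, g x i :=
  ((EuclideanSpace.proj (𝕜 := ℝ) i : Plane →L[ℝ] ℝ).intervalIntegral_comp_comm hg).symm

/-- Fundamental theorem of calculus for absolutely continuous plane-valued functions. -/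
theorem integral_eq_sub_of_ae_hasDerivAt {f g : ℝ → Plane} {a b : ℝ}
    (hf : AbsolutelyContinuousOnInterval f a b)
    (hg : ∀ᵐ x, x ∈ uIcc a b → HasDerivAt f (g x) x) :
    IntervalIntegrable g volume a b ∧ ∫ x in a..b, g x = f b - f a := by
  have hae (i : Fin 2) : ∀ᵐ x, x ∈ uIoc a b → deriv (fun x ↦ f x i) x = g x i := by
    filter_upwards [hg] with x hx hxm
    exact (hasDerivAt_coord (hx (uIoc_subset_uIcc hxm)) i).deriv
  have hint : IntervalIntegrable g volume a b := by
    refine intervalIntegrable_coord_iff.2 fun i ↦ ?_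
    refine (absolutelyContinuousOnInterval_coord hf i).intervalIntegrable_deriv.congr_ae ?_
    exact (ae_restrict_iff' measurableSet_uIoc).2 (hae i)
  refine ⟨hint, ?_⟩
  ext i
  rw [intervalIntegral_coord hint, ← intervalIntegral.integral_congr_ae (hae i),
    (absolutelyContinuousOnInterval_coord hf i).integral_deriv_eq_sub]
  rfl

theorem absolutelyContinuousOnInterval_integral {g : ℝ → Plane} {a b : ℝ}
    (hg : IntervalIntegrable g volume a b) :
    AbsolutelyContinuousOnInterval (fun x ↦ ∫ t in a..x, g t) a b := by
  refine absolutelyContinuousOnInterval_of_coord fun i ↦ ?_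
  have h := (intervalIntegrable_coord_iff.1 hg
    i).absolutelyContinuousOnInterval_intervalIntegral (c := a) left_mem_uIcc
  refine h.congr_uIcc fun x hx ↦ ?_
  exact (intervalIntegral_coord (hg.mono_set (uIcc_subset_uIcc_left hx)) i).symm

/-! ### Weak derivatives and curves of class `H²` -/

/-- Test functions on `(0,1)`: smooth functions with compact support in the open interval. -/
structure IsTestFunction (φ : ℝ → ℝ) : Prop where
  contDiff : ContDiff ℝ ∞ φ
  hasCompactSupport : HasCompactSupport φ
  tsupport_subset : tsupport φ ⊆ Ioo 0 1

namespace IsTestFunction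

variable {φ ψ : ℝ → ℝ}

theorem deriv (hφ : IsTestFunction φ) : IsTestFunction (deriv φ) where
  contDiff := (contDiff_infty_iff_deriv.1 hφ.contDiff).2
  hasCompactSupport := hφ.hasCompactSupport.deriv
  tsupport_subset := (tsupport_deriv_subset ).trans hφ.tsupport_subset

theorem continuous (hφ : IsTestFunction φ) : Continuous φ := hφ.contDiff.continuous

theorem hasDerivAt (hφ : IsTestFunction φ) (x : ℝ) : HasDerivAt φ (_root_.deriv φ x) x :=
  (hφ.contDiff.differentiable (by simp) x).hasDerivAt

theorem eq_zero_of_notMem (hφ : IsTestFunction φ) {x : ℝ} (hx : x ∉ Ioo (0 : ℝ) 1) : φ x = 0 :=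
  image_eq_zero_of_notMem_tsupport fun h ↦ hx (hφ.tsupport_subset h)

theorem sub_const_mul (hφ : IsTestFunction φ) (hψ : IsTestFunction ψ) (m : ℝ) :
    IsTestFunction (fun x ↦ φ x - m * ψ x) where
  contDiff := hφ.contDiff.sub (contDiff_const.mul hψ.contDiff)
  hasCompactSupport := hφ.hasCompactSupport.sub hψ.hasCompactSupport.mul_left
  tsupport_subset := by
    refine (tsupport_sub φ (fun x ↦ m * ψ x)).trans (union_subset hφ.tsupport_subset ?_)
    exact (closure_mono (Function.support_mul_subset_right _ _)).trans hψ.tsupport_subset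

theorem of_support_subset {a b : ℝ} (hφ : ContDiff ℝ ∞ φ) (ha : 0 < a) (hb : b < 1)
    (h : ∀ x, x ∉ Icc a b → φ x = 0) : IsTestFunction φ := by
  have hsub : tsupport φ ⊆ Icc a b :=
    closure_minimal (fun x hx ↦ by_contra fun hn ↦ hx (h x hn)) isClosed_Icc
  exact ⟨hφ, isCompact_Icc.of_isClosed_subset (isClosed_tsupport _) hsub,
    hsub.trans fun x hx ↦ ⟨ha.trans_le hx.1, hx.2.trans_lt hb⟩⟩

theorem exists_support_subset (hφ : IsTestFunction φ) :
    ∃ a b : ℝ, 0 < a ∧ a ≤ b ∧ b < 1 ∧ ∀ x, x ∉ Icc a b → φ x = 0 := by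
  rcases (tsupport φ).eq_empty_or_nonempty with h | h
  · refine ⟨1 / 2, 1 / 2, by norm_num, le_rfl, by norm_num, fun x _ ↦ ?_⟩
    exact image_eq_zero_of_notMem_tsupport (by simp [h])
  · have hc : IsCompact (tsupport φ) := hφ.hasCompactSupport
    obtain ⟨a, ha⟩ := hc.exists_isLeast h
    obtain ⟨b, hb⟩ := hc.exists_isGreatest h
    refine ⟨a, b, (hφ.tsupport_subset ha.1).1, ha.2 hb.1, (hφ.tsupport_subset hb.1).2,
      fun x hx ↦ image_eq_zero_of_notMem_tsupport fun hm ↦ hx ⟨ha.2 hm, hb.2 hm⟩⟩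

theorem exists_integral_eq_one : ∃ χ, IsTestFunction χ ∧ ∫ x in (0 : ℝ)..1, χ x = 1 := by
  let f : ContDiffBump (1 / 2 : ℝ) := ⟨1 / 8, 1 / 4, by norm_num, by norm_num⟩
  have hχ : IsTestFunction (f.normed volume) := by
    refine of_support_subset (a := 1 / 4) (b := 3 / 4) f.contDiff_normed (by norm_num)
      (by norm_num) fun x hx ↦ ?_
    by_contra hne
    have : x ∈ Function.support (f.normed volume) := hne
    rw [f.support_normed_eq, Metric.mem_ball, Real.dist_eq] at this
    have h2 := abs_lt.1 this
    simp only [f] at h2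
    exact hx ⟨by linarith [h2.1], by linarith [h2.2]⟩
  refine ⟨_, hχ, ?_⟩
  rw [intervalIntegral.integral_of_le zero_le_one]
  refine Eq.trans ?_ (f.integral_normed (μ := volume))
  refine setIntegral_eq_integral_of_forall_compl_eq_zero fun x hx ↦ ?_
  exact hχ.eq_zero_of_notMem fun h ↦ hx ⟨h.1, h.2.le⟩

/-- A test function of mean zero is the derivative of a test function. -/
theorem exists_primitive (hψ : IsTestFunction ψ) (h0 : ∫ x in (0 : ℝ)..1, ψ x = 0) :
    ∃ φ, IsTestFunction φ ∧ _root_.deriv φ = ψ := by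
  obtain ⟨a, b, ha, hab, hb, hz⟩ := hψ.exists_support_subset
  have hd (x : ℝ) : HasDerivAt (fun y ↦ ∫ t in (0 : ℝ)..y, ψ t) (ψ x) x :=
    intervalIntegral.integral_hasDerivAt_right (hψ.continuous.intervalIntegrable _ _)
      hψ.continuous.stronglyMeasurable.stronglyMeasurableAtFilter hψ.continuous.continuousAt
  have hde : _root_.deriv (fun y ↦ ∫ t in (0 : ℝ)..y, ψ t) = ψ := funext fun x ↦ (hd x).deriv
  refine ⟨fun y ↦ ∫ t in (0 : ℝ)..y, ψ t, of_support_subset ?_ ha hb fun x hx ↦ ?_, hde⟩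
  · exact contDiff_infty_iff_deriv.2 ⟨fun x ↦ (hd x).differentiableAt, by rw [hde]; exact hψ.contDiff⟩
  · by_cases hxa : x < a
    · have : ∫ t in (0 : ℝ)..x, ψ t = ∫ t in (0 : ℝ)..x, (0 : ℝ) := by
        refine intervalIntegral.integral_congr fun t ht ↦ hz t fun hm ↦ ?_
        rcases mem_uIcc.1 ht with h | h <;> linarith [hm.1, h.2]
      simpa using this
    · have hxb : b < x := by
        by_contra hn
        exact hx ⟨not_lt.1 hxa, not_lt.1 hn⟩
      have : ∫ t in (1 : ℝ)..x, ψ t = ∫ t in (1 : ℝ)..x, (0 : ℝ) := by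
        refine intervalIntegral.integral_congr fun t ht ↦ hz t fun hm ↦ ?_
        rcases mem_uIcc.1 ht with h | h <;> linarith [hm.2, h.1]
      have hadd := intervalIntegral.integral_add_adjacent_intervals
        (hψ.continuous.intervalIntegrable (μ := volume) 0 1) (hψ.continuous.intervalIntegrable 1 x)
      rw [h0, this] at hadd
      simpa using hadd.symm

end IsTestFunction

theorem integral_Ioo_eq {E : Type*} [NormedAddCommGroup E] [NormedSpace ℝ E] (f : ℝ → E) :
    ∫ x in Ioo (0 : ℝ) 1, f x = ∫ x in (0 : ℝ)..1, f x := by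
  rw [intervalIntegral.integral_of_le zero_le_one, integral_Ioc_eq_integral_Ioo]

theorem intervalIntegrable_iff_Ioo {E : Type*} [NormedAddCommGroup E] {f : ℝ → E} :
    IntervalIntegrable f volume 0 1 ↔ IntegrableOn f (Ioo (0 : ℝ) 1) :=
  intervalIntegrable_iff_integrableOn_Ioo_of_le zero_le_one

theorem isWeakDeriv_iff {f g : ℝ → Plane} : IsWeakDeriv f g ↔ ∀ φ, IsTestFunction φ →
    ∫ x in (0 : ℝ)..1, deriv φ x • f x = -∫ x in (0 : ℝ)..1, φ x • g x := by
  simp only [IsWeakDeriv, integral_Ioo_eq]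
  exact ⟨fun h φ hφ ↦ h φ hφ.1 hφ.2 hφ.3, fun h φ h1 h2 h3 ↦ h φ ⟨h1, h2, h3⟩⟩

theorem IsTestFunction.intervalIntegrable_smul {φ : ℝ → ℝ} (hφ : IsTestFunction φ)
    {f : ℝ → Plane} (hf : IntervalIntegrable f volume 0 1) :
    IntervalIntegrable (fun x ↦ φ x • f x) volume 0 1 :=
  hf.continuousOn_smul hφ.continuous.continuousOn

/-- If `f'' = g'` in the sense of distributions on `(0,1)`, then `f' = g - c` for a constant `c`. -/
theorem exists_isWeakDeriv_sub_const {f g : ℝ → Plane} (hf : IntervalIntegrable f volume 0 1)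
    (hg : IntervalIntegrable g volume 0 1)
    (h : ∀ φ, IsTestFunction φ → (∫ x in (0 : ℝ)..1, deriv (deriv φ) x • f x) +
      ∫ x in (0 : ℝ)..1, deriv φ x • g x = 0) :
    ∃ c : Plane, IsWeakDeriv f (fun x ↦ g x - c) := by
  -- The functional `ψ ↦ ∫ (ψ' f + ψ g)` vanishes on derivatives of test functions, that is, on test
  -- functions of mean zero, so it is `c` times the mean, where `c` is its value at a test function
  -- `χ` of mean one.
  obtain ⟨χ, hχ, hχ1⟩ := IsTestFunction.exists_integral_eq_one
  refine ⟨(∫ x in (0 : ℝ)..1, deriv χ x • f x) + ∫ x in (0 : ℝ)..1, χ x • g x,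
    isWeakDeriv_iff.2 fun ψ hψ ↦ ?_⟩
  set m := ∫ x in (0 : ℝ)..1, ψ x with hm
  obtain ⟨φ, hφ, hφd⟩ := (hψ.sub_const_mul hχ m).exists_primitive (by
    rw [intervalIntegral.integral_sub (hψ.continuous.intervalIntegrable _ _)
      ((hχ.continuous.intervalIntegrable _ _).const_mul m), intervalIntegral.integral_const_mul,
      hχ1, ← hm]
    simp)
  have hd : deriv (deriv φ) = fun x ↦ deriv ψ x - m * deriv χ x := by
    rw [hφd]
    funext x
    exact ((hψ.hasDerivAt x).sub ((hχ.hasDerivAt x).const_mul m)).deriv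
  have hsub {p q : ℝ → ℝ} {u : ℝ → Plane} (hp : IsTestFunction p) (hq : IsTestFunction q)
      (hu : IntervalIntegrable u volume 0 1) : ∫ x in (0 : ℝ)..1, (p x - m * q x) • u x =
        (∫ x in (0 : ℝ)..1, p x • u x) - m • ∫ x in (0 : ℝ)..1, q x • u x := by
    have hqi : IntervalIntegrable (fun x ↦ m • q x • u x) volume 0 1 :=
      (hq.intervalIntegrable_smul hu).smul m
    rw [← intervalIntegral.integral_smul, ← intervalIntegral.integral_sub
      (hp.intervalIntegrable_smul hu) hqi]
    simp only [sub_smul, mul_smul]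
  have key := h φ hφ
  rw [hd, hφd] at key
  rw [hsub hψ.deriv hχ.deriv hf, hsub hψ hχ hg] at key
  simp only [smul_sub]
  rw [intervalIntegral.integral_sub (hψ.intervalIntegrable_smul hg)
    (hψ.intervalIntegrable_smul intervalIntegrable_const), intervalIntegral.integral_smul_const,
    ← hm]
  rw [← sub_eq_zero, ← key]
  module

/-- The du Bois-Reymond lemma. -/
theorem exists_ae_eq_const {f : ℝ → Plane} (hf : IntervalIntegrable f volume 0 1)
    (h : ∀ φ, IsTestFunction φ → ∫ x in (0 : ℝ)..1, deriv φ x • f x = 0) :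
    ∃ c : Plane, ∀ᵐ x, x ∈ Ioo (0 : ℝ) 1 → f x = c := by
  obtain ⟨c, hc⟩ := exists_isWeakDeriv_sub_const (f := fun _ ↦ 0) (g := f)
    intervalIntegrable_const hf (by simpa using h)
  refine ⟨c, ?_⟩
  have hint : IntegrableOn (fun x ↦ f x - c) (Ioo (0 : ℝ) 1) :=
    intervalIntegrable_iff_Ioo.1 (hf.sub intervalIntegrable_const)
  have h0 (g : ℝ → ℝ) (h1 : ContDiff ℝ ∞ g) (h2 : HasCompactSupport g)
      (h3 : tsupport g ⊆ Ioo 0 1) : ∫ x, g x • (f x - c) = 0 := by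
    have h4 := hc g h1 h2 h3
    rw [← setIntegral_eq_integral_of_forall_compl_eq_zero (s := Ioo 0 1) fun x hx ↦ ?_]
    · simpa using h4
    · rw [IsTestFunction.eq_zero_of_notMem ⟨h1, h2, h3⟩ hx, zero_smul]
  filter_upwards [isOpen_Ioo.ae_eq_zero_of_integral_contDiff_smul_eq_zero
    hint.locallyIntegrableOn h0] with x hx hm using sub_eq_zero.1 (hx hm)

/-- Integration by parts: the almost everywhere derivative of an absolutely continuous function is
its weak derivative. -/
theorem isWeakDeriv_of_ae_hasDerivAt {f g : ℝ → Plane} (hf : AbsolutelyContinuousOnInterval f 0 1)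
    (hg : ∀ᵐ x, x ∈ Icc (0 : ℝ) 1 → HasDerivAt f (g x) x) : IsWeakDeriv f g := by
  refine isWeakDeriv_iff.2 fun φ hφ ↦ ?_
  rw [← uIcc_of_le zero_le_one] at hg
  have hφac : AbsolutelyContinuousOnInterval φ 0 1 :=
    (hφ.contDiff.of_le (by simp)).contDiffOn.absolutelyContinuousOnInterval
  have h1 := (integral_eq_sub_of_ae_hasDerivAt hf hg).1
  have h := (integral_eq_sub_of_ae_hasDerivAt (hφac.smul hf)
    (g := fun x ↦ φ x • g x + deriv φ x • f x) (by
      filter_upwards [hg] with x hx hm using (hφ.hasDerivAt x).smul (hx hm))).2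
  rw [intervalIntegral.integral_add (hφ.intervalIntegrable_smul h1)
    (hφ.deriv.intervalIntegrable_smul hf.continuousOn.intervalIntegrable)] at h
  simp only [Pi.smul_apply', hφ.eq_zero_of_notMem (x := 0) (by simp),
    hφ.eq_zero_of_notMem (x := 1) (by simp), zero_smul, sub_zero] at h
  exact eq_neg_of_add_eq_zero_right h

theorem ae_hasDerivAt_integral {g : ℝ → Plane} (hg : IntervalIntegrable g volume 0 1) :
    ∀ᵐ x, x ∈ Icc (0 : ℝ) 1 → HasDerivAt (fun y ↦ ∫ t in (0 : ℝ)..y, g t) (g x) x := by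
  have h := hg.ae_hasDerivAt_integral
  rw [uIcc_of_le zero_le_one] at h
  filter_upwards [h] with x hx hm using hx hm 0 (by simp)

/-- A function with an integrable weak derivative has an absolutely continuous representative. -/
theorem IsWeakDeriv.exists_ae_eq {f g : ℝ → Plane} (h : IsWeakDeriv f g)
    (hf : IntervalIntegrable f volume 0 1) (hg : IntervalIntegrable g volume 0 1) :
    ∃ c : Plane, ∀ᵐ x, x ∈ Ioo (0 : ℝ) 1 → f x = c + ∫ t in (0 : ℝ)..x, g t := by
  have hac := absolutelyContinuousOnInterval_integral hg
  have hF := hac.continuousOn.intervalIntegrable (μ := volume)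
  obtain ⟨c, hc⟩ := exists_ae_eq_const (hf.sub hF) fun φ hφ ↦ by
    simp only [smul_sub]
    rw [intervalIntegral.integral_sub (hφ.deriv.intervalIntegrable_smul hf)
      (hφ.deriv.intervalIntegrable_smul hF), isWeakDeriv_iff.1 h φ hφ, isWeakDeriv_iff.1
      (isWeakDeriv_of_ae_hasDerivAt hac (ae_hasDerivAt_integral hg)) φ hφ, sub_self]
  exact ⟨c, by filter_upwards [hc] with x hx hm using sub_eq_iff_eq_add.1 (hx hm)⟩

theorem hasDerivWithinAt_integral_Icc {E : Type*} [NormedAddCommGroup E] [NormedSpace ℝ E]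
    [CompleteSpace E] {v : ℝ → E} (hv : ContinuousOn v (Icc 0 1)) {x : ℝ}
    (hx : x ∈ Icc (0 : ℝ) 1) :
    HasDerivWithinAt (fun y ↦ ∫ t in (0 : ℝ)..y, v t) (v x) (Icc 0 1) x := by
  have : Fact (x ∈ Icc (0 : ℝ) 1) := ⟨hx⟩
  refine intervalIntegral.integral_hasDerivWithinAt_right (t := Icc 0 1) ?_ ?_ (hv x hx)
  · refine (hv.mono ?_).intervalIntegrable
    rw [uIcc_of_le hx.1]
    exact Icc_subset_Icc_right hx.2
  · exact hv.stronglyMeasurableAtFilter_nhdsWithin measurableSet_Icc x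

/-- `v` and `w` are the first and the second derivative of a curve `γ` of class `H²`: `v` is the
derivative of `γ` at every point of `[0,1]`, it is absolutely continuous, and `w ∈ L²(0,1)` is its
derivative almost everywhere. -/
structure HasH2Derivs (γ v w : ℝ → Plane) : Prop where
  hasDerivWithinAt : ∀ x ∈ Icc (0 : ℝ) 1, HasDerivWithinAt γ (v x) (Icc 0 1) x
  ac : AbsolutelyContinuousOnInterval v 0 1
  ae_hasDerivAt : ∀ᵐ x, x ∈ Icc (0 : ℝ) 1 → HasDerivAt v (w x) x
  isL2 : IsL2 w

theorem IsL2.intervalIntegrable {f : ℝ → Plane} (hf : IsL2 f) :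
    IntervalIntegrable f volume 0 1 :=
  intervalIntegrable_iff_Ioo.2 (hf.integrable (by norm_num))

theorem isL2_of_continuousOn {f : ℝ → Plane} (hf : ContinuousOn f (Icc 0 1)) : IsL2 f := by
  obtain ⟨C, hC⟩ := isCompact_Icc.exists_bound_of_continuousOn hf
  refine MemLp.of_bound ((hf.mono Ioo_subset_Icc_self).aestronglyMeasurable measurableSet_Ioo) C ?_
  exact (ae_restrict_iff' measurableSet_Ioo).2 (.of_forall fun x hx ↦ hC x (Ioo_subset_Icc_self hx))

theorem ae_of_ae_Ioo {p : ℝ → Prop} (h : ∀ᵐ x, x ∈ Ioo (0 : ℝ) 1 → p x) :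
    ∀ᵐ x, x ∈ Icc (0 : ℝ) 1 → p x := by
  rw [← ae_restrict_iff' measurableSet_Ioo] at h
  rw [← ae_restrict_iff' measurableSet_Icc, ← restrict_Ioo_eq_restrict_Icc]
  exact h

/-- The continuous representative of a curve of class `H²` is continuously differentiable on `[0,1]`
with absolutely continuous derivative. -/
theorem IsH2.exists_hasH2Derivs {γ : ℝ → Plane} (h : IsH2 γ) : ∃ v w, HasH2Derivs γ v w := by
  obtain ⟨hc, hγ, g₁, g₂, h₁, h₂, hw₁, hw₂⟩ := h
  obtain ⟨c₁, hc₁⟩ := hw₂.exists_ae_eq h₁.intervalIntegrable h₂.intervalIntegrable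
  obtain ⟨c₀, hc₀⟩ := hw₁.exists_ae_eq hγ.intervalIntegrable h₁.intervalIntegrable
  set v : ℝ → Plane := fun x ↦ c₁ + ∫ t in (0 : ℝ)..x, g₂ t with hv
  have hconst : AbsolutelyContinuousOnInterval (fun _ : ℝ ↦ c₁) 0 1 :=
    (contDiffOn_const (n := 1)).absolutelyContinuousOnInterval
  have hac : AbsolutelyContinuousOnInterval v 0 1 :=
    hconst.add (absolutelyContinuousOnInterval_integral h₂.intervalIntegrable)
  have hvc : ContinuousOn v (Icc 0 1) := by
    rw [← uIcc_of_le zero_le_one]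
    exact hac.continuousOn
  have hint (x : ℝ) (hx : x ∈ Icc (0 : ℝ) 1) :
      ∫ t in (0 : ℝ)..x, g₁ t = ∫ t in (0 : ℝ)..x, v t := by
    refine intervalIntegral.integral_congr_ae ?_
    filter_upwards [ae_of_ae_Ioo hc₁] with t ht htm
    rw [uIoc_of_le hx.1] at htm
    exact ht ⟨htm.1.le, htm.2.trans hx.2⟩
  have hd (x : ℝ) (hx : x ∈ Icc (0 : ℝ) 1) :
      HasDerivWithinAt (fun y ↦ c₀ + ∫ t in (0 : ℝ)..y, v t) (v x) (Icc 0 1) x :=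
    (hasDerivWithinAt_integral_Icc hvc hx).const_add c₀
  have hEq : EqOn γ (fun y ↦ c₀ + ∫ t in (0 : ℝ)..y, v t) (Icc 0 1) := by
    refine Measure.eqOn_Icc_of_ae_eq volume zero_ne_one ?_ hc
      (fun x hx ↦ (hd x hx).continuousWithinAt)
    refine (ae_restrict_iff' measurableSet_Icc).2 ?_
    filter_upwards [ae_of_ae_Ioo hc₀] with x hx hm
    rw [hx hm, hint x hm]
  refine ⟨v, g₂, fun x hx ↦ (hd x hx).congr hEq (hEq hx), hac, ?_, h₂⟩
  filter_upwards [ae_hasDerivAt_integral h₂.intervalIntegrable] with x hx hm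
  exact (hx hm).const_add c₁

namespace HasH2Derivs

variable {γ v w : ℝ → Plane}

theorem continuousOn (h : HasH2Derivs γ v w) : ContinuousOn v (Icc 0 1) := by
  rw [← uIcc_of_le zero_le_one]
  exact h.ac.continuousOn

theorem isH2 (h : HasH2Derivs γ v w) : IsH2 γ := by
  have hc : ContinuousOn γ (Icc 0 1) := fun x hx ↦ (h.hasDerivWithinAt x hx).continuousWithinAt
  have hEq : EqOn (fun x ↦ γ 0 + ∫ t in (0 : ℝ)..x, v t) γ (uIcc 0 1) := by
    intro x hx
    rw [uIcc_of_le zero_le_one] at hx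
    have hvi : IntervalIntegrable v volume 0 x := by
      refine (h.continuousOn.mono ?_).intervalIntegrable
      rw [uIcc_of_le hx.1]
      exact Icc_subset_Icc_right hx.2
    have := intervalIntegral.integral_eq_sub_of_hasDerivAt_of_le hx.1
      (hc.mono (Icc_subset_Icc_right hx.2)) (fun y hy ↦
        (h.hasDerivWithinAt y ⟨hy.1.le, hy.2.le.trans hx.2⟩).hasDerivAt
          (Icc_mem_nhds hy.1 (hy.2.trans_le hx.2))) hvi
    simp only [this, add_sub_cancel]
  have hac : AbsolutelyContinuousOnInterval γ 0 1 := by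
    have hconst : AbsolutelyContinuousOnInterval (fun _ : ℝ ↦ γ 0) 0 1 :=
      (contDiffOn_const (n := 1)).absolutelyContinuousOnInterval
    exact (hconst.add (absolutelyContinuousOnInterval_integral
      (isL2_of_continuousOn h.continuousOn).intervalIntegrable)).congr_uIcc hEq
  refine ⟨hc, isL2_of_continuousOn hc, v, w, isL2_of_continuousOn h.continuousOn, h.isL2, ?_,
    isWeakDeriv_of_ae_hasDerivAt h.ac h.ae_hasDerivAt⟩
  refine isWeakDeriv_of_ae_hasDerivAt hac (ae_of_ae_Ioo (.of_forall fun x hx ↦ ?_))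
  exact (h.hasDerivWithinAt x (Ioo_subset_Icc_self hx)).hasDerivAt (Icc_mem_nhds hx.1 hx.2)

theorem dX_eq (h : HasH2Derivs γ v w) {x : ℝ} (hx : x ∈ Icc (0 : ℝ) 1) : dX γ x = v x :=
  (h.hasDerivWithinAt x hx).derivWithin (uniqueDiffOn_Icc zero_lt_one x hx)

theorem dX_dX_ae_eq (h : HasH2Derivs γ v w) :
    ∀ᵐ x, x ∈ Icc (0 : ℝ) 1 → dX (dX γ) x = w x := by
  filter_upwards [h.ae_hasDerivAt] with x hx hm
  exact ((hx hm).hasDerivWithinAt.congr (fun y hy ↦ h.dX_eq hy) (h.dX_eq hm)).derivWithin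
    (uniqueDiffOn_Icc zero_lt_one x hm)

end HasH2Derivs

/-! ### Curvature and elastic energy of curves of class `H²` -/

/-- The anticlockwise rotation of the plane by `π / 2`. -/
def quarterTurn (p : Plane) : Plane := !₂[-(p 1), p 0]

theorem inner_plane (p q : Plane) : inner ℝ p q = p 0 * q 0 + p 1 * q 1 := by
  simp [PiLp.inner_apply, Fin.sum_univ_two, mul_comm]

theorem inner_self_quarterTurn (p : Plane) : inner ℝ p (quarterTurn p) = 0 := by
  simp [inner_plane, quarterTurn]
  ring

theorem quarterTurn_smul (r : ℝ) (p : Plane) : quarterTurn (r • p) = r • quarterTurn p := by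
  ext i
  fin_cases i <;> simp [quarterTurn]

theorem norm_sq_plane (p : Plane) : ‖p‖ ^ 2 = p 0 ^ 2 + p 1 ^ 2 := by
  rw [← real_inner_self_eq_norm_sq, inner_plane]
  ring

/-- Pythagoras: `p` and its quarter turn are orthogonal of equal length. -/
theorem inner_sq_add_inner_quarterTurn_sq (a p : Plane) :
    (inner ℝ p a : ℝ) ^ 2 + inner ℝ a (quarterTurn p) ^ 2 = ‖a‖ ^ 2 * ‖p‖ ^ 2 := by
  simp only [norm_sq_plane, inner_plane, quarterTurn, Matrix.cons_val_zero,
    Matrix.cons_val_one]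
  ring

theorem hasDerivWithinAt_norm {v : ℝ → Plane} {a : Plane} {s : Set ℝ} {x : ℝ}
    (hv : HasDerivWithinAt v a s x) (h0 : v x ≠ 0) :
    HasDerivWithinAt (fun y ↦ ‖v y‖) (inner ℝ (v x) a / ‖v x‖) s x := by
  have h := hv.norm_sq.sqrt (by positivity)
  simp only [Real.sqrt_sq (norm_nonneg _)] at h
  exact h.congr_deriv (by field_simp)

/-- The derivative of a normalized vector field is the normalized component of the derivative
orthogonal to the field. -/
theorem hasDerivWithinAt_normalize {v : ℝ → Plane} {a : Plane} {s : Set ℝ} {x : ℝ}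
    (hv : HasDerivWithinAt v a s x) (h0 : v x ≠ 0) :
    HasDerivWithinAt (fun y ↦ ‖v y‖⁻¹ • v y)
      (‖v x‖⁻¹ • (a - (inner ℝ (v x) a / ‖v x‖ ^ 2) • v x)) s x := by
  have hn : ‖v x‖ ≠ 0 := norm_ne_zero_iff.2 h0
  refine (((hasDerivWithinAt_norm hv h0).fun_inv hn).fun_smul hv).congr_deriv ?_
  match_scalars <;> field_simp

/-- The derivative of a vector field of constant length is orthogonal to it. -/
theorem inner_eq_zero_of_norm_eq {v : ℝ → Plane} {L : ℝ}
    (hL : ∀ x ∈ Icc (0 : ℝ) 1, ‖v x‖ = L) {x : ℝ} {a : Plane} (hx : x ∈ Icc (0 : ℝ) 1)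
    (ha : HasDerivWithinAt v a (Icc 0 1) x) : inner ℝ (v x) a = (0 : ℝ) := by
  have h1 := ha.norm_sq
  have h2 : HasDerivWithinAt (fun y ↦ ‖v y‖ ^ 2) 0 (Icc 0 1) x :=
    (hasDerivWithinAt_const x _ (L ^ 2)).congr (fun y hy ↦ by rw [hL y hy]) (by rw [hL x hx])
  have h3 := (uniqueDiffOn_Icc zero_lt_one x hx).eq_deriv _ h1 h2
  linarith

namespace HasH2Derivs

variable {γ v w : ℝ → Plane}

theorem isRegularCurve_iff (h : HasH2Derivs γ v w) :
    IsRegularCurve γ ↔ ∀ x ∈ Icc (0 : ℝ) 1, v x ≠ 0 :=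
  forall₂_congr fun x hx ↦ by rw [h.dX_eq hx]

theorem tangent_eq (h : HasH2Derivs γ v w) {x : ℝ} (hx : x ∈ Icc (0 : ℝ) 1) :
    tangent γ x = ‖v x‖⁻¹ • v x := by
  rw [tangent, dS, h.dX_eq hx]

theorem dS_tangent_eq (h : HasH2Derivs γ v w) {x : ℝ} {a : Plane} (hx : x ∈ Icc (0 : ℝ) 1)
    (h0 : v x ≠ 0) (ha : HasDerivWithinAt v a (Icc 0 1) x) :
    dS γ (tangent γ) x = ‖v x‖⁻¹ • ‖v x‖⁻¹ • (a - (inner ℝ (v x) a / ‖v x‖ ^ 2) • v x) := by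
  rw [dS, h.dX_eq hx, dX]
  congr 1
  exact ((hasDerivWithinAt_normalize ha h0).congr (fun y hy ↦ h.tangent_eq hy)
    (h.tangent_eq hx)).derivWithin (uniqueDiffOn_Icc zero_lt_one x hx)

theorem curvature_eq (h : HasH2Derivs γ v w) {x : ℝ} {a : Plane} (hx : x ∈ Icc (0 : ℝ) 1)
    (h0 : v x ≠ 0) (ha : HasDerivWithinAt v a (Icc 0 1) x) :
    curvature γ x = inner ℝ a (quarterTurn (v x)) / ‖v x‖ ^ 3 := by
  have hn : normal γ x = ‖v x‖⁻¹ • quarterTurn (v x) := by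
    rw [← quarterTurn_smul, ← h.tangent_eq hx, normal, quarterTurn]
  rw [curvature, h.dS_tangent_eq hx h0 ha, hn]
  simp only [inner_smul_left, inner_smul_right, inner_sub_left, inner_self_quarterTurn]
  have hn : ‖v x‖ ≠ 0 := norm_ne_zero_iff.2 h0
  simp
  field_simp

theorem arcLength_eq (h : HasH2Derivs γ v w) : arcLength γ = ∫ x in (0 : ℝ)..1, ‖v x‖ := by
  refine intervalIntegral.integral_congr fun x hx ↦ ?_
  rw [uIcc_of_le zero_le_one] at hx
  simp only [h.dX_eq hx]

theorem elasticEnergy_eq (h : HasH2Derivs γ v w) (hreg : IsRegularCurve γ) :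
    elasticEnergy γ =
      ∫ x in (0 : ℝ)..1, (inner ℝ (w x) (quarterTurn (v x)) ^ 2 / ‖v x‖ ^ 5 + ‖v x‖) := by
  refine intervalIntegral.integral_congr_ae ?_
  filter_upwards [h.ae_hasDerivAt] with x hx hm
  rw [uIoc_of_le zero_le_one] at hm
  have hm' := Ioc_subset_Icc_self hm
  have h0 := h.isRegularCurve_iff.1 hreg x hm'
  have hn : ‖v x‖ ≠ 0 := norm_ne_zero_iff.2 h0
  rw [h.curvature_eq hm' h0 (hx hm').hasDerivWithinAt, h.dX_eq hm']
  field_simp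

theorem constSpeedEnergy_eq (h : HasH2Derivs γ v w) :
    constSpeedEnergy γ =
      1 / arcLength γ ^ 3 * (∫ x in (0 : ℝ)..1, ‖w x‖ ^ 2) + arcLength γ := by
  rw [constSpeedEnergy]
  congr 2
  refine intervalIntegral.integral_congr_ae ?_
  filter_upwards [h.dX_dX_ae_eq] with x hx hm
  rw [uIoc_of_le zero_le_one] at hm
  rw [hx (Ioc_subset_Icc_self hm)]

theorem intervalIntegrable_norm_sq (h : HasH2Derivs γ v w) :
    IntervalIntegrable (fun x ↦ ‖w x‖ ^ 2) volume 0 1 :=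
  intervalIntegrable_iff_Ioo.2 ((memLp_two_iff_integrable_sq_norm h.isL2.1).1 h.isL2)

/-- The elastic energy is at most `∫ (|γ''|² / |γ'|³ + |γ'|)`: only the component of `γ''` normal to
the curve contributes to the curvature. -/
theorem elasticEnergy_le (h : HasH2Derivs γ v w) (hreg : IsRegularCurve γ)
    (hint : IntervalIntegrable (fun x ↦ ‖w x‖ ^ 2 / ‖v x‖ ^ 3 + ‖v x‖) volume 0 1) :
    elasticEnergy γ ≤ ∫ x in (0 : ℝ)..1, (‖w x‖ ^ 2 / ‖v x‖ ^ 3 + ‖v x‖) := by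
  rw [h.elasticEnergy_eq hreg, intervalIntegral.integral_of_le zero_le_one,
    intervalIntegral.integral_of_le zero_le_one]
  refine integral_mono_of_nonneg (.of_forall fun x ↦ by positivity) hint.1 ?_
  refine (ae_restrict_iff' measurableSet_Ioc).2 (.of_forall fun x hx ↦ ?_)
  have hn : 0 < ‖v x‖ :=
    norm_pos_iff.2 (h.isRegularCurve_iff.1 hreg x (Ioc_subset_Icc_self hx))
  have := inner_sq_add_inner_quarterTurn_sq (w x) (v x)
  refine add_le_add ?_ le_rfl
  rw [div_le_div_iff₀ (by positivity) (by positivity)]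
  have h5 : ‖w x‖ ^ 2 * ‖v x‖ ^ 5 = ‖w x‖ ^ 2 * ‖v x‖ ^ 2 * ‖v x‖ ^ 3 := by ring
  rw [h5, ← this, add_mul]
  exact le_add_of_nonneg_left (by positivity)

theorem elasticEnergy_eq_constSpeedEnergy (h : HasH2Derivs γ v w) (hreg : IsRegularCurve γ)
    (hL : ∀ x ∈ Icc (0 : ℝ) 1, ‖v x‖ = arcLength γ) :
    elasticEnergy γ = constSpeedEnergy γ := by
  have hpos : 0 < arcLength γ := by
    rw [← hL 0 (by simp)]
    exact norm_pos_iff.2 (h.isRegularCurve_iff.1 hreg 0 (by simp))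
  have hi : IntervalIntegrable (fun x ↦ 1 / arcLength γ ^ 3 * ‖w x‖ ^ 2) volume 0 1 :=
    h.intervalIntegrable_norm_sq.const_mul _
  have : elasticEnergy γ =
      ∫ x in (0 : ℝ)..1, (1 / arcLength γ ^ 3 * ‖w x‖ ^ 2 + arcLength γ) := by
    rw [h.elasticEnergy_eq hreg]
    refine intervalIntegral.integral_congr_ae ?_
    filter_upwards [h.ae_hasDerivAt] with x hx hm
    rw [uIoc_of_le zero_le_one] at hm
    have hm' := Ioc_subset_Icc_self hm
    have h1 := inner_sq_add_inner_quarterTurn_sq (w x) (v x)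
    rw [inner_eq_zero_of_norm_eq hL hm' (hx hm').hasDerivWithinAt, hL x hm'] at h1
    have h2 : inner ℝ (w x) (quarterTurn (v x)) ^ 2 = ‖w x‖ ^ 2 * arcLength γ ^ 2 := by
      linarith
    rw [h2, hL x hm']
    field_simp
  rw [this, h.constSpeedEnergy_eq, intervalIntegral.integral_add hi intervalIntegrable_const,
    intervalIntegral.integral_const_mul]
  simp

end HasH2Derivs

/-! ### Reparametrization by constant speed -/

/-- A `C¹` function with positive derivative mapping `[0,1]` onto `[0,1]` has a monotone Lipschitz
differentiable inverse. -/
theorem exists_inverse_on_unitInterval {σ r : ℝ → ℝ}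
    (hσ : ∀ x ∈ Icc (0 : ℝ) 1, HasDerivWithinAt σ (r x) (Icc 0 1) x)
    (hr : ContinuousOn r (Icc 0 1)) (hpos : ∀ x ∈ Icc (0 : ℝ) 1, 0 < r x) (h0 : σ 0 = 0)
    (h1 : σ 1 = 1) :
    ∃ ψ : ℝ → ℝ, MapsTo ψ (Icc 0 1) (Icc 0 1) ∧ (∀ y ∈ Icc (0 : ℝ) 1, σ (ψ y) = y) ∧
      MapsTo σ (Icc 0 1) (Icc 0 1) ∧ StrictMonoOn σ (Icc 0 1) ∧
      (∀ x ∈ Icc (0 : ℝ) 1, ψ (σ x) = x) ∧ MonotoneOn ψ (Icc 0 1) ∧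
      (∃ K, LipschitzOnWith K ψ (Icc 0 1)) ∧
      ∀ y ∈ Icc (0 : ℝ) 1, HasDerivWithinAt ψ (r (ψ y))⁻¹ (Icc 0 1) y := by
  have h0m : (0 : ℝ) ∈ Icc (0 : ℝ) 1 := by simp
  have h1m : (1 : ℝ) ∈ Icc (0 : ℝ) 1 := by simp
  -- The minimum `r x₀ > 0` of the derivative makes `σ` expanding, so the inverse is Lipschitz.
  obtain ⟨x₀, hx₀, hmin⟩ := isCompact_Icc.exists_isMinOn ⟨0, h0m⟩ hr
  have hc : ContinuousOn σ (Icc 0 1) := fun x hx ↦ (hσ x hx).continuousWithinAt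
  have hd (x : ℝ) (hx : x ∈ interior (Icc (0 : ℝ) 1)) : HasDerivAt σ (r x) x := by
    rw [interior_Icc] at hx
    exact (hσ x (Ioo_subset_Icc_self hx)).hasDerivAt (Icc_mem_nhds hx.1 hx.2)
  have hm : 0 < r x₀ := hpos x₀ hx₀
  have hexp : ∀ x ∈ Icc (0 : ℝ) 1, ∀ y ∈ Icc (0 : ℝ) 1, x ≤ y → r x₀ * (y - x) ≤ σ y - σ x :=
    (convex_Icc 0 1).mul_sub_le_image_sub_of_le_deriv hc
      (fun x hx ↦ (hd x hx).differentiableAt.differentiableWithinAt)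
      (fun x hx ↦ by rw [(hd x hx).deriv]; exact hmin (interior_subset hx))
  have hmono : StrictMonoOn σ (Icc 0 1) := fun x hx y hy hxy ↦ by
    have := hexp x hx y hy hxy.le
    have := mul_pos hm (sub_pos.2 hxy)
    linarith
  have hmaps : MapsTo σ (Icc 0 1) (Icc 0 1) := fun x hx ↦
    ⟨h0 ▸ hmono.monotoneOn h0m hx hx.1, h1 ▸ hmono.monotoneOn hx h1m hx.2⟩
  have hsurj (y : ℝ) (hy : y ∈ Icc (0 : ℝ) 1) : ∃ x ∈ Icc (0 : ℝ) 1, σ x = y := by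
    have := intermediate_value_Icc zero_le_one hc
    rw [h0, h1] at this
    exact this hy
  set ψ := Function.invFunOn σ (Icc (0 : ℝ) 1) with hψ
  have hψm : MapsTo ψ (Icc 0 1) (Icc 0 1) := fun y hy ↦ Function.invFunOn_mem (hsurj y hy)
  have hσψ (y : ℝ) (hy : y ∈ Icc (0 : ℝ) 1) : σ (ψ y) = y := Function.invFunOn_eq (hsurj y hy)
  have hψmono : MonotoneOn ψ (Icc 0 1) := fun x hx y hy hxy ↦ by
    by_contra hlt
    have := hmono (hψm hy) (hψm hx) (not_le.1 hlt)
    rw [hσψ x hx, hσψ y hy] at this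
    linarith
  have hlip : LipschitzOnWith (Real.toNNReal (r x₀)⁻¹) ψ (Icc 0 1) := by
    refine LipschitzOnWith.of_dist_le_mul fun x hx y hy ↦ ?_
    rw [Real.coe_toNNReal _ (inv_pos.2 hm).le]
    wlog hxy : x ≤ y generalizing x y
    · rw [dist_comm, dist_comm x]
      exact this y hy x hx (le_of_not_ge hxy)
    have h2 := hψmono hx hy hxy
    have h3 := hexp _ (hψm hx) _ (hψm hy) h2
    rw [hσψ x hx, hσψ y hy] at h3
    rw [dist_comm, dist_comm x, Real.dist_eq, Real.dist_eq, abs_of_nonneg (sub_nonneg.2 h2),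
      abs_of_nonneg (sub_nonneg.2 hxy), inv_mul_eq_div, le_div_iff₀ hm]
    linarith
  refine ⟨ψ, hψm, hσψ, hmaps, hmono, fun x hx ↦ hmono.injOn (hψm (hmaps hx)) hx
    (hσψ _ (hmaps hx)), hψmono, ⟨_, hlip⟩, fun y hy ↦ ?_⟩
  have hne : r (ψ y) ≠ 0 := (hpos _ (hψm hy)).ne'
  have hfd : HasFDerivWithinAt σ
      ((ContinuousLinearEquiv.unitsEquivAut ℝ (Units.mk0 (r (ψ y)) hne) : ℝ ≃L[ℝ] ℝ) : ℝ →L[ℝ] ℝ)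
      (Icc 0 1) (ψ y) := by
    refine (hσ _ (hψm hy)).hasFDerivWithinAt.congr_fderiv ?_
    ext
    simp
  have := hfd.of_local_left_inverse
    ((hlip.continuousOn y hy).tendsto_nhdsWithin hψm) hy
    (eventually_mem_nhdsWithin.mono hσψ)
  refine this.hasDerivWithinAt.congr_deriv ?_
  simp

/-- Normalizing a nowhere vanishing field preserves absolute continuity, since inversion is Lipschitz
away from zero. -/
theorem absolutelyContinuousOnInterval_normalize {v : ℝ → Plane} {a b : ℝ}
    (hv : AbsolutelyContinuousOnInterval v a b) (h0 : ∀ x ∈ uIcc a b, v x ≠ 0) :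
    AbsolutelyContinuousOnInterval (fun x ↦ ‖v x‖⁻¹ • v x) a b := by
  obtain ⟨x₀, hx₀, hmin⟩ := isCompact_uIcc.exists_isMinOn nonempty_uIcc hv.continuousOn.norm
  have hm : 0 < ‖v x₀‖ := norm_pos_iff.2 (h0 x₀ hx₀)
  have hnorm : AbsolutelyContinuousOnInterval (fun x ↦ ‖v x‖) a b :=
    hv.lipschitzOnWith_comp (Φ := fun p : Plane ↦ ‖p‖) (s := univ)
      lipschitzWith_one_norm.lipschitzOnWith (mapsTo_univ _ _)
  have hlip : LipschitzOnWith (Real.toNNReal (‖v x₀‖ ^ 2)⁻¹) (fun r : ℝ ↦ r⁻¹) (Ici ‖v x₀‖) := by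
    refine LipschitzOnWith.of_dist_le_mul fun x hx y hy ↦ ?_
    rw [Real.coe_toNNReal _ (by positivity)]
    have hx' : 0 < x := hm.trans_le hx
    have hy' : 0 < y := hm.trans_le hy
    rw [Real.dist_eq, Real.dist_eq, inv_sub_inv hx'.ne' hy'.ne', abs_div, abs_sub_comm,
      div_eq_inv_mul, abs_of_pos (mul_pos hx' hy')]
    gcongr
    rw [sq]
    exact mul_le_mul hx hy hm.le hx'.le
  exact (hnorm.lipschitzOnWith_comp hlip fun x hx ↦ hmin hx).smul hv

namespace HasH2Derivs

variable {γ v w : ℝ → Plane}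

/-- The integrand is `k² |γ'|`, written in terms of the derivatives of `γ`. -/
theorem intervalIntegrable_curvature_sq (h : HasH2Derivs γ v w) (hreg : IsRegularCurve γ) :
    IntervalIntegrable (fun x ↦ inner ℝ (w x) (quarterTurn (v x)) ^ 2 / ‖v x‖ ^ 5) volume 0 1 := by
  have h0 (x : ℝ) (hx : x ∈ Icc (0 : ℝ) 1) : 0 < ‖v x‖ :=
    norm_pos_iff.2 (h.isRegularCurve_iff.1 hreg x hx)
  have hdom : IntervalIntegrable (fun x ↦ ‖w x‖ ^ 2 * (‖v x‖ ^ 3)⁻¹) volume 0 1 := by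
    refine h.intervalIntegrable_norm_sq.mul_continuousOn ?_
    rw [uIcc_of_le zero_le_one]
    exact (h.continuousOn.norm.pow 3).inv₀ fun x hx ↦ (pow_pos (h0 x hx) 3).ne'
  have hw : AEStronglyMeasurable w (volume.restrict (uIoc 0 1)) :=
    h.isL2.intervalIntegrable.aestronglyMeasurable_restrict_uIoc
  have hcont : ContinuousOn v (uIoc 0 1) := h.continuousOn.mono (by
    rw [uIoc_of_le zero_le_one]
    exact Ioc_subset_Icc_self)
  have hv : AEStronglyMeasurable v (volume.restrict (uIoc 0 1)) :=
    hcont.aestronglyMeasurable measurableSet_uIoc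
  have hJ : Continuous quarterTurn := by
    unfold quarterTurn
    fun_prop
  have hmeas := ((hw.inner (hJ.comp_aestronglyMeasurable hv) (𝕜 := ℝ)).pow 2).div₀ (hv.norm.pow 5)
  refine hdom.mono_fun hmeas ?_
  refine (ae_restrict_iff' measurableSet_uIoc).2 (.of_forall fun x hx ↦ ?_)
  rw [uIoc_of_le zero_le_one] at hx
  have hn := h0 x (Ioc_subset_Icc_self hx)
  have := inner_sq_add_inner_quarterTurn_sq (w x) (v x)
  simp only
  rw [Real.norm_of_nonneg (by positivity), Real.norm_of_nonneg (by positivity), ← div_eq_mul_inv,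
    div_le_div_iff₀ (by positivity) (by positivity)]
  have h5 : ‖w x‖ ^ 2 * ‖v x‖ ^ 5 = ‖w x‖ ^ 2 * ‖v x‖ ^ 2 * ‖v x‖ ^ 3 := by ring
  rw [h5, ← this, add_mul]
  exact le_add_of_nonneg_left (by positivity)

theorem arcLength_pos (h : HasH2Derivs γ v w) (hreg : IsRegularCurve γ) : 0 < arcLength γ := by
  rw [h.arcLength_eq]
  refine intervalIntegral.intervalIntegral_pos_of_pos_on
    (ContinuousOn.intervalIntegrable (by
      rw [uIcc_of_le zero_le_one]
      exact h.continuousOn.norm)) (fun x hx ↦ ?_) zero_lt_one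
  exact norm_pos_iff.2 (h.isRegularCurve_iff.1 hreg x (Ioo_subset_Icc_self hx))

/-- A regular curve of class `H²` has a reparametrization of constant speed, of class `H²`, with the
same boundary conditions and the same elastic energy. -/
theorem exists_constSpeed (h : HasH2Derivs γ v w) (hreg : IsRegularCurve γ) :
    ∃ γ' : ℝ → Plane, IsH2 γ' ∧ IsRegularCurve γ' ∧
      (∀ x ∈ Icc (0 : ℝ) 1, ‖dX γ' x‖ = arcLength γ') ∧ SameBoundary γ' γ ∧
      constSpeedEnergy γ' = elasticEnergy γ := by
  set ℓ := arcLength γ with hℓ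
  have hpos : 0 < ℓ := h.arcLength_pos hreg
  have h0 (x : ℝ) (hx : x ∈ Icc (0 : ℝ) 1) : v x ≠ 0 := h.isRegularCurve_iff.1 hreg x hx
  have hn (x : ℝ) (hx : x ∈ Icc (0 : ℝ) 1) : 0 < ‖v x‖ := norm_pos_iff.2 (h0 x hx)
  have hnc : ContinuousOn (fun x ↦ ‖v x‖) (Icc 0 1) := h.continuousOn.norm
  -- The new parameter `σ` is arclength divided by the total length `ℓ`, and `ψ` is its inverse.
  set σ : ℝ → ℝ := fun x ↦ ℓ⁻¹ * ∫ t in (0 : ℝ)..x, ‖v t‖ with hσdef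
  have hσ (x : ℝ) (hx : x ∈ Icc (0 : ℝ) 1) :
      HasDerivWithinAt σ (ℓ⁻¹ * ‖v x‖) (Icc 0 1) x :=
    (hasDerivWithinAt_integral_Icc hnc hx).const_mul _
  have hσ1 : σ 1 = 1 := by
    simp only [hσdef]
    rw [← h.arcLength_eq, ← hℓ, inv_mul_cancel₀ hpos.ne']
  obtain ⟨ψ, hψm, hσψ, hσm, hσmono, hψσ, hψmono, ⟨K, hψlip⟩, hψd⟩ :=
    exists_inverse_on_unitInterval hσ (hnc.const_smul ℓ⁻¹)
      (fun x hx ↦ mul_pos (inv_pos.2 hpos) (hn x hx)) (by simp [hσdef]) hσ1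
  -- `D` is the derivative of the unit tangent; `v'` and `w'` are the derivatives of `γ ∘ ψ`.
  set D : ℝ → Plane := fun x ↦
    ‖v x‖⁻¹ • (w x - (inner ℝ (v x) (w x) / ‖v x‖ ^ 2) • v x) with hD
  set v' : ℝ → Plane := fun y ↦ ℓ • (‖v (ψ y)‖⁻¹ • v (ψ y)) with hv'
  set w' : ℝ → Plane := fun y ↦ ℓ • ((ℓ⁻¹ * ‖v (ψ y)‖)⁻¹ • D (ψ y)) with hw'
  have hder (y : ℝ) (hy : y ∈ Icc (0 : ℝ) 1) :
      HasDerivWithinAt (γ ∘ ψ) (v' y) (Icc 0 1) y := by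
    refine ((h.hasDerivWithinAt _ (hψm hy)).scomp y (hψd y hy) hψm).congr_deriv ?_
    simp only [hv', smul_smul, mul_inv, inv_inv]
  have hac : AbsolutelyContinuousOnInterval v' 0 1 := by
    have h1 := absolutelyContinuousOnInterval_normalize h.ac (by
      rw [uIcc_of_le zero_le_one]
      exact h0)
    rw [← uIcc_of_le zero_le_one] at hψlip hψmono hψm
    exact (h1.comp_monotoneOn_lipschitzOnWith hψlip hψmono hψm).const_smul ℓ
  have hae : ∀ᵐ y, y ∈ Icc (0 : ℝ) 1 → HasDerivAt v' (w' y) y := by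
    -- The exceptional parameters form the image under `σ` of a null set, which is a null set.
    have hnull : volume {x | ¬(x ∈ Icc (0 : ℝ) 1 → HasDerivAt v (w x) x)} = 0 := h.ae_hasDerivAt
    have himg := addHaar_image_eq_zero_of_differentiableOn_of_addHaar_eq_zero volume (f := σ)
      (s := {x | ¬(x ∈ Icc (0 : ℝ) 1 → HasDerivAt v (w x) x)}) (fun x hx ↦ by
        have hx' : x ∈ Icc (0 : ℝ) 1 ∧ ¬HasDerivAt v (w x) x := Classical.not_imp.1 hx
        refine (hσ x hx'.1).differentiableWithinAt.mono fun z hz ↦ ?_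
        exact (Classical.not_imp.1 hz).1) hnull
    refine ae_of_ae_Ioo ?_
    filter_upwards [measure_eq_zero_iff_ae_notMem.1 himg] with y hy hyI
    have hyI' := Ioo_subset_Icc_self hyI
    have hv : HasDerivAt v (w (ψ y)) (ψ y) := by
      by_contra hcon
      exact hy ⟨ψ y, Classical.not_imp.2 ⟨hψm hyI', hcon⟩, hσψ y hyI'⟩
    have h2 := hasDerivWithinAt_normalize (s := Icc 0 1) hv.hasDerivWithinAt (h0 _ (hψm hyI'))
    exact ((h2.scomp y (hψd y hyI') hψm).const_smul ℓ).hasDerivAt (Icc_mem_nhds hyI.1 hyI.2)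
  have himage : σ '' Icc 0 1 = Icc 0 1 :=
    Subset.antisymm hσm.image_subset fun y hy ↦ ⟨ψ y, hψm hy, hσψ y hy⟩
  have hnormD (x : ℝ) (hx : x ∈ Icc (0 : ℝ) 1) :
      |ℓ⁻¹ * ‖v x‖| • ‖w' (σ x)‖ ^ 2 =
        ℓ ^ 3 * (inner ℝ (w x) (quarterTurn (v x)) ^ 2 / ‖v x‖ ^ 5) := by
    have hnx := hn x hx
    have h1 := inner_sq_add_inner_quarterTurn_sq (w x) (v x)
    have h2 : ‖w x - (inner ℝ (v x) (w x) / ‖v x‖ ^ 2) • v x‖ ^ 2 =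
        inner ℝ (w x) (quarterTurn (v x)) ^ 2 / ‖v x‖ ^ 2 := by
      rw [norm_sub_sq_real, inner_smul_right, norm_smul, real_inner_comm, mul_pow,
        Real.norm_eq_abs, sq_abs, eq_div_iff (by positivity)]
      rw [real_inner_comm] at h1
      field_simp
      linarith
    simp only [hw', hD, hψσ x hx, norm_smul, mul_pow, norm_inv, norm_mul, norm_norm, h2,
      Real.norm_of_nonneg hpos.le, smul_eq_mul]
    rw [abs_of_pos (mul_pos (inv_pos.2 hpos) hnx)]
    field_simp
  have hcurv := (h.intervalIntegrable_curvature_sq hreg).const_mul (ℓ ^ 3)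
  have hL2 : IsL2 w' := by
    have hmeas := (integral_eq_sub_of_ae_hasDerivAt hac (by
      rw [uIcc_of_le zero_le_one]
      exact hae)).1.1.aestronglyMeasurable
    rw [restrict_Ioo_eq_restrict_Ioc.symm] at hmeas
    refine (memLp_two_iff_integrable_sq_norm hmeas).2 ?_
    refine IntegrableOn.mono_set (t := Icc 0 1) ?_ Ioo_subset_Icc_self
    rw [← himage, integrableOn_image_iff_integrableOn_abs_deriv_smul measurableSet_Icc hσ
      hσmono.injOn, integrableOn_congr_fun (fun x hx ↦ hnormD x hx) measurableSet_Icc]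
    exact (intervalIntegrable_iff_integrableOn_Icc_of_le zero_le_one).1 hcurv
  have h' : HasH2Derivs (γ ∘ ψ) v' w' := ⟨hder, hac, hae, hL2⟩
  have hspeed (y : ℝ) (hy : y ∈ Icc (0 : ℝ) 1) : ‖v' y‖ = ℓ := by
    have := hn _ (hψm hy)
    simp only [hv', norm_smul, norm_inv, norm_norm, Real.norm_of_nonneg hpos.le]
    field_simp
  have hlen : arcLength (γ ∘ ψ) = ℓ := by
    rw [h'.arcLength_eq, intervalIntegral.integral_congr (g := fun _ ↦ ℓ) fun y hy ↦ by
      rw [uIcc_of_le zero_le_one] at hy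
      exact hspeed y hy]
    simp
  have hbd (x : ℝ) (hx : x ∈ Icc (0 : ℝ) 1) (hψx : ψ x = x) :
      (γ ∘ ψ) x = γ x ∧ tangent (γ ∘ ψ) x = tangent γ x := by
    rw [h'.tangent_eq hx, h.tangent_eq hx, hspeed x hx]
    simp only [Function.comp_apply, hv', hψx]
    exact ⟨trivial, inv_smul_smul₀ hpos.ne' _⟩
  refine ⟨γ ∘ ψ, h'.isH2, h'.isRegularCurve_iff.2 fun y hy h0 ↦ ?_, fun y hy ↦ ?_, ?_, ?_⟩
  · have := hspeed y hy
    rw [h0, norm_zero] at this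
    exact hpos.ne this
  · rw [h'.dX_eq hy, hspeed y hy, hlen]
  · rintro x (rfl | rfl)
    · refine hbd 0 (by simp) ?_
      have := hψσ 0 (by simp)
      rwa [show σ 0 = 0 by simp [hσdef]] at this
    · refine hbd 1 (by simp) ?_
      have := hψσ 1 (by simp)
      rwa [hσ1] at this
  · have hint : ∫ y in (0 : ℝ)..1, ‖w' y‖ ^ 2 =
        ℓ ^ 3 * ∫ x in (0 : ℝ)..1, inner ℝ (w x) (quarterTurn (v x)) ^ 2 / ‖v x‖ ^ 5 := by
      rw [← intervalIntegral.integral_const_mul, intervalIntegral.integral_of_le zero_le_one,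
        intervalIntegral.integral_of_le zero_le_one, ← integral_Icc_eq_integral_Ioc,
        ← integral_Icc_eq_integral_Ioc]
      conv_lhs => rw [← himage]
      rw [integral_image_eq_integral_abs_deriv_smul measurableSet_Icc hσ hσmono.injOn]
      exact setIntegral_congr_fun measurableSet_Icc hnormD
    rw [h'.constSpeedEnergy_eq, hlen, hint, h.elasticEnergy_eq hreg, intervalIntegral.integral_add
      (h.intervalIntegrable_curvature_sq hreg) (by
        refine ContinuousOn.intervalIntegrable ?_
        rwa [uIcc_of_le zero_le_one]), ← h.arcLength_eq, ← hℓ]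
    field_simp

end HasH2Derivs

/-! ### Minimizing networks -/

theorem hasH2Derivs_of_hasDerivAt {γ v w : ℝ → Plane} (hv : ∀ x, HasDerivAt γ (v x) x)
    (hw : ∀ x, HasDerivAt v (w x) x) (hc : Continuous w) : HasH2Derivs γ v w where
  hasDerivWithinAt x _ := (hv x).hasDerivWithinAt
  ac := by
    refine ContDiffOn.absolutelyContinuousOnInterval (ContDiff.contDiffOn ?_)
    refine contDiff_one_iff_deriv.2 ⟨fun x ↦ (hw x).differentiableAt, ?_⟩
    rwa [show deriv v = w from funext fun x ↦ (hw x).deriv]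
  ae_hasDerivAt := .of_forall fun x _ ↦ hw x
  isL2 := isL2_of_continuousOn hc.continuousOn

/-- For a unit vector `e`, the circle of length one through the origin with unit tangent `e` there,
run through anticlockwise with constant speed on `[0,1]`. -/
noncomputable def circleThrough (e : Plane) (x : ℝ) : Plane :=
  (2 * Real.pi)⁻¹ • (Real.sin (2 * Real.pi * x) • e +
    (1 - Real.cos (2 * Real.pi * x)) • quarterTurn e)

theorem hasH2Derivs_circleThrough (e : Plane) :
    HasH2Derivs (circleThrough e)
      (fun x ↦ Real.cos (2 * Real.pi * x) • e + Real.sin (2 * Real.pi * x) • quarterTurn e)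
      (fun x ↦ (2 * Real.pi) • (-Real.sin (2 * Real.pi * x) • e +
        Real.cos (2 * Real.pi * x) • quarterTurn e)) := by
  have hlin (x : ℝ) : HasDerivAt (fun x ↦ 2 * Real.pi * x) (2 * Real.pi) x := by
    simpa using (hasDerivAt_id x).const_mul (2 * Real.pi)
  have hpi : (2 * Real.pi) ≠ 0 := by positivity
  refine hasH2Derivs_of_hasDerivAt (fun x ↦ ?_) (fun x ↦ ?_) (by fun_prop)
  · refine (((hlin x).sin.smul_const e).add
      (((hlin x).cos.const_sub 1).smul_const (quarterTurn e)) |>.const_smul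
        (2 * Real.pi)⁻¹).congr_deriv ?_
    match_scalars <;> field_simp
  · refine (((hlin x).cos.smul_const e).add
      ((hlin x).sin.smul_const (quarterTurn e))).congr_deriv ?_
    match_scalars <;> ring

theorem norm_quarterTurn (p : Plane) : ‖quarterTurn p‖ = ‖p‖ := by
  rw [← sq_eq_sq₀ (norm_nonneg _) (norm_nonneg _), norm_sq_plane, norm_sq_plane]
  simp [quarterTurn]
  ring

theorem norm_cos_smul_add_sin_smul (e : Plane) (he : ‖e‖ = 1) (t : ℝ) :
    ‖Real.cos t • e + Real.sin t • quarterTurn e‖ = 1 := by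
  rw [← sq_eq_sq₀ (norm_nonneg _) zero_le_one, norm_add_sq_real, norm_smul, norm_smul,
    norm_quarterTurn, he, inner_smul_left, inner_smul_right, inner_self_quarterTurn]
  simp

theorem isRegularCurve_circleThrough {e : Plane} (he : ‖e‖ = 1) :
    IsRegularCurve (circleThrough e) := by
  refine (hasH2Derivs_circleThrough e).isRegularCurve_iff.2 fun x _ h0 ↦ ?_
  have := norm_cos_smul_add_sin_smul e he (2 * Real.pi * x)
  rw [h0, norm_zero] at this
  exact zero_ne_one this

theorem norm_dX_circleThrough {e : Plane} (he : ‖e‖ = 1) {x : ℝ} (hx : x ∈ Icc (0 : ℝ) 1) :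
    ‖dX (circleThrough e) x‖ = arcLength (circleThrough e) := by
  rw [(hasH2Derivs_circleThrough e).dX_eq hx, (hasH2Derivs_circleThrough e).arcLength_eq]
  simp [norm_cos_smul_add_sin_smul e he]

theorem tangent_circleThrough {e : Plane} (he : ‖e‖ = 1) :
    tangent (circleThrough e) 0 = e ∧ tangent (circleThrough e) 1 = e := by
  rw [(hasH2Derivs_circleThrough e).tangent_eq (by simp),
    (hasH2Derivs_circleThrough e).tangent_eq (by simp)]
  simp [he]

theorem hasH2Derivs_zero : HasH2Derivs (fun _ ↦ 0) (fun _ ↦ 0) (fun _ ↦ 0) :=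
  hasH2Derivs_of_hasDerivAt (fun _ ↦ hasDerivAt_const _ _) (fun _ ↦ hasDerivAt_const _ _)
    continuous_const

/-- Two circles through the origin whose tangents there form an angle of `120` degrees, together
with a constant curve, are a degenerate Theta-network. -/
noncomputable def twoCircles : ThreeNetwork where
  curve := ![circleThrough !₂[1, 0], circleThrough !₂[-1 / 2, √3 / 2], fun _ ↦ 0]
  isH2 i := by
    fin_cases i
    · exact (hasH2Derivs_circleThrough _).isH2
    · exact (hasH2Derivs_circleThrough _).isH2
    · exact hasH2Derivs_zero.isH2
  start_eq i j := by fin_cases i <;> fin_cases j <;> simp [circleThrough]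
  end_eq i j := by fin_cases i <;> fin_cases j <;> simp [circleThrough]
  const_speed i hi x hx := by
    fin_cases i
    · exact norm_dX_circleThrough (by simp [EuclideanSpace.norm_eq]) hx
    · refine norm_dX_circleThrough ?_ hx
      rw [← sq_eq_sq₀ (norm_nonneg _) zero_le_one, norm_sq_plane]
      simp [div_pow]
      norm_num
    · exact absurd rfl (hasH2Derivs_zero.isRegularCurve_iff.1 hi x hx)

theorem isDegenerateTheta_twoCircles : twoCircles.IsDegenerateTheta := by
  have h1 : ‖(!₂[1, 0] : Plane)‖ = 1 := by simp [EuclideanSpace.norm_eq]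
  have h2 : ‖(!₂[-1 / 2, √3 / 2] : Plane)‖ = 1 := by
    rw [← sq_eq_sq₀ (norm_nonneg _) zero_le_one, norm_sq_plane]
    simp [div_pow]
    norm_num
  refine ⟨0, 1, 2, by decide, by decide, by decide, isRegularCurve_circleThrough h1,
    isRegularCurve_circleThrough h2, ?_, ?_, Or.inl ⟨?_, ?_⟩⟩
  · exact (hasH2Derivs_zero.arcLength_eq).trans (by simp)
  · change InnerProductGeometry.angle (tangent (circleThrough _) 0) (tangent (circleThrough _) 0) = _
    rw [(tangent_circleThrough h1).1, (tangent_circleThrough h2).1, InnerProductGeometry.angle,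
      h1, h2, inner_plane]
    have : Real.cos (2 * Real.pi / 3) = -1 / 2 := by
      rw [show 2 * Real.pi / 3 = Real.pi - Real.pi / 3 by ring, Real.cos_pi_sub,
        Real.cos_pi_div_three]
      norm_num
    rw [← Real.arccos_cos (x := 2 * Real.pi / 3) (by positivity) (by linarith [Real.pi_pos]), this]
    simp
  · exact (tangent_circleThrough h1).2.trans (tangent_circleThrough h1).1.symm
  · exact (tangent_circleThrough h2).2.trans (tangent_circleThrough h2).1.symm

/-- A minimizer has finite energy, because `twoCircles` has. -/
theorem ThreeNetwork.IsMinimizer.isTheta_or_isDegenerateTheta {Γ : ThreeNetwork}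
    (hΓ : Γ.IsMinimizer) : Γ.IsTheta ∨ Γ.IsDegenerateTheta := by
  by_contra! hcon
  have h1 := hΓ twoCircles
  rw [ThreeNetwork.energyBar, if_neg hcon.1, if_neg hcon.2, ThreeNetwork.energyBar,
    if_pos isDegenerateTheta_twoCircles, top_le_iff] at h1
  split_ifs at h1
  · exact EReal.coe_ne_top _ h1
  · exact EReal.coe_ne_top _ h1

namespace ThreeNetwork

variable {Γ Γ' : ThreeNetwork}

/-- A network with the same regular curves, the same curves of length zero and the same tangents at
the junctions as a minimizer is of the same type, so both energies are sums over the same set `s`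
of curves. -/
theorem exists_sum_of_isMinimizer (hΓ : Γ.IsMinimizer)
    (hreg : ∀ j, IsRegularCurve (Γ'.curve j) ↔ IsRegularCurve (Γ.curve j))
    (hlen : ∀ j, arcLength (Γ'.curve j) = 0 ↔ arcLength (Γ.curve j) = 0)
    (htan : ∀ j, ∀ x ∈ ({0, 1} : Set ℝ), tangent (Γ'.curve j) x = tangent (Γ.curve j) x) :
    ∃ s : Finset (Fin 3), (∀ j, IsRegularCurve (Γ.curve j) → j ∈ s) ∧
      ∑ j ∈ s, constSpeedEnergy (Γ.curve j) ≤ ∑ j ∈ s, constSpeedEnergy (Γ'.curve j) := by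
  classical
  have ht0 (j) := htan j 0 (by simp)
  have ht1 (j) := htan j 1 (by simp)
  have hth : Γ'.IsTheta ↔ Γ.IsTheta := by
    simp only [IsTheta, hreg, mem_insert_iff, mem_singleton_iff, forall_eq_or_imp, forall_eq,
      ht0, ht1]
  have hdeg : Γ'.IsDegenerateTheta ↔ Γ.IsDegenerateTheta := by
    simp only [IsDegenerateTheta, hreg, ht0, ht1, hlen]
  have hle := hΓ Γ'
  by_cases h : Γ.IsTheta
  · rw [energyBar, energyBar, if_pos h, if_pos (hth.2 h), EReal.coe_le_coe_iff] at hle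
    exact ⟨Finset.univ, by simp, hle⟩
  · have hd := hΓ.isTheta_or_isDegenerateTheta.resolve_left h
    rw [energyBar, energyBar, if_neg h, if_neg (mt hth.1 h), if_pos hd, if_pos (hdeg.2 hd),
      EReal.coe_le_coe_iff] at hle
    simp only [hreg] at hle
    refine ⟨Finset.univ.filter fun j ↦ IsRegularCurve (Γ.curve j), by simp, ?_⟩
    convert hle

/-- Exchanging a regular curve of a minimizing network for a curve of constant speed with the same
boundary conditions does not lower the energy. -/
theorem IsMinimizer.constSpeedEnergy_le (hΓ : Γ.IsMinimizer) {i : Fin 3}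
    (hi : IsRegularCurve (Γ.curve i)) {γ : ℝ → Plane} (hγ : IsH2 γ) (hreg : IsRegularCurve γ)
    (hspeed : ∀ x ∈ Icc (0 : ℝ) 1, ‖dX γ x‖ = arcLength γ)
    (hbd : SameBoundary γ (Γ.curve i)) :
    constSpeedEnergy (Γ.curve i) ≤ constSpeedEnergy γ := by
  obtain ⟨v, w, h⟩ := hγ.exists_hasH2Derivs
  obtain ⟨v', w', h'⟩ := (Γ.isH2 i).exists_hasH2Derivs
  have hval (x : ℝ) (hx : x ∈ ({0, 1} : Set ℝ)) (j : Fin 3) :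
      Function.update Γ.curve i γ j x = Γ.curve j x := by
    rcases eq_or_ne j i with rfl | hj
    · rw [Function.update_self, (hbd x hx).1]
    · rw [Function.update_of_ne hj]
  let Γ' : ThreeNetwork :=
    { curve := Function.update Γ.curve i γ
      isH2 j := by
        rcases eq_or_ne j i with rfl | hj
        · rwa [Function.update_self]
        · rw [Function.update_of_ne hj]
          exact Γ.isH2 j
      start_eq j l := by
        rw [hval 0 (by simp), hval 0 (by simp)]
        exact Γ.start_eq j l
      end_eq j l := by
        rw [hval 1 (by simp), hval 1 (by simp)]
        exact Γ.end_eq j l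
      const_speed j hj := by
        rcases eq_or_ne j i with rfl | hji
        · rwa [Function.update_self]
        · rw [Function.update_of_ne hji] at hj ⊢
          exact Γ.const_speed j hj }
  have hself : Γ'.curve i = γ := Function.update_self _ _ _
  have hne {j : Fin 3} (hj : j ≠ i) : Γ'.curve j = Γ.curve j := Function.update_of_ne hj _ _
  obtain ⟨s, hs, hle⟩ := exists_sum_of_isMinimizer (Γ' := Γ') hΓ
    (fun j ↦ by
      rcases eq_or_ne j i with rfl | hj
      · simp only [hself, hreg, hi]
      · rw [hne hj])
    (fun j ↦ by
      rcases eq_or_ne j i with rfl | hj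
      · simp only [hself, (h.arcLength_pos hreg).ne', (h'.arcLength_pos hi).ne']
      · rw [hne hj])
    (fun j x hx ↦ by
      rcases eq_or_ne j i with rfl | hj
      · rw [hself, (hbd x hx).2]
      · rw [hne hj])
  rw [← Finset.add_sum_erase s _ (hs i hi), ← Finset.add_sum_erase s _ (hs i hi), hself,
    Finset.sum_congr rfl fun j hj ↦ by rw [← hne (Finset.ne_of_mem_erase hj)]] at hle
  exact le_of_add_le_add_right hle

/-- The regular curves of a minimizing network minimize the elastic energy among all regular
curves with the same boundary conditions. -/
theorem IsMinimizer.elasticEnergy_le (hΓ : Γ.IsMinimizer) {i : Fin 3}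
    (hi : IsRegularCurve (Γ.curve i)) {γ : ℝ → Plane} (hγ : IsH2 γ) (hreg : IsRegularCurve γ)
    (hbd : SameBoundary γ (Γ.curve i)) : elasticEnergy (Γ.curve i) ≤ elasticEnergy γ := by
  obtain ⟨v, w, h⟩ := hγ.exists_hasH2Derivs
  obtain ⟨v', w', h'⟩ := (Γ.isH2 i).exists_hasH2Derivs
  obtain ⟨γ', hγ', hreg', hspeed, hbd', hE⟩ := h.exists_constSpeed hreg
  rw [h'.elasticEnergy_eq_constSpeedEnergy hi fun x hx ↦ by
    rw [← h'.dX_eq hx, Γ.const_speed i hi x hx], ← hE]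
  exact hΓ.constSpeedEnergy_le hi hγ' hreg' hspeed fun x hx ↦
    ⟨(hbd' x hx).1.trans (hbd x hx).1, (hbd' x hx).2.trans (hbd x hx).2⟩

end ThreeNetwork

/-! ### The first variation -/

/-- The derivative of `|γ''|² / |γ'|³ + |γ'|` along a variation, at one parameter: `p`, `q` are the
first and second derivative of the curve, `a`, `b` those of the variation. -/
theorem hasDerivAt_energyDensity {p q a b : Plane} {t : ℝ} (h0 : p + t • a ≠ 0) :
    HasDerivAt (fun t : ℝ ↦ ‖q + t • b‖ ^ 2 / ‖p + t • a‖ ^ 3 + ‖p + t • a‖)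
      (2 * inner ℝ (q + t • b) b / ‖p + t • a‖ ^ 3
        - 3 * ‖q + t • b‖ ^ 2 * inner ℝ (p + t • a) a / ‖p + t • a‖ ^ 5
        + inner ℝ (p + t • a) a / ‖p + t • a‖) t := by
  have hlin (p a : Plane) : HasDerivAt (fun t : ℝ ↦ p + t • a) a t := by
    simpa using ((hasDerivAt_id t).smul_const a).const_add p
  have hn : ‖p + t • a‖ ≠ 0 := norm_ne_zero_iff.2 h0
  have hr := hasDerivWithinAt_univ.1 (hasDerivWithinAt_norm (hlin p a).hasDerivWithinAt h0)
  refine (((hlin q b).norm_sq.fun_div (hr.fun_pow 3) (pow_ne_zero 3 hn)).add hr).congr_deriv ?_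
  field_simp
  ring

/-- A bound, uniform in `t` and integrable for `q = γ''`, for the derivative in
`hasDerivAt_energyDensity`. -/
theorem abs_energyDensity_deriv_le {p q a b : Plane} {t l M : ℝ} (hl : 0 < l)
    (hp : l ≤ ‖p + t • a‖) (ha : ‖a‖ ≤ M) (hb : ‖b‖ ≤ M) (ht : |t| ≤ 1) :
    ‖2 * inner ℝ (q + t • b) b / ‖p + t • a‖ ^ 3
        - 3 * ‖q + t • b‖ ^ 2 * inner ℝ (p + t • a) a / ‖p + t • a‖ ^ 5
        + inner ℝ (p + t • a) a / ‖p + t • a‖‖ ≤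
      2 * (‖q‖ + M) * M / l ^ 3 + 3 * (‖q‖ + M) ^ 2 * M / l ^ 4 + M := by
  set r := ‖p + t • a‖ with hr
  have hrpos : 0 < r := hl.trans_le hp
  have hM : 0 ≤ M := (norm_nonneg a).trans ha
  have hq : ‖q + t • b‖ ≤ ‖q‖ + M := by
    refine (norm_add_le _ _).trans ?_
    rw [norm_smul, Real.norm_eq_abs]
    have := mul_le_mul ht hb (norm_nonneg b) zero_le_one
    linarith
  have h1 : |inner ℝ (q + t • b) b| ≤ (‖q‖ + M) * M :=
    (abs_real_inner_le_norm _ _).trans (mul_le_mul hq hb (norm_nonneg _) (by positivity))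
  have h2 : |inner ℝ (p + t • a) a| ≤ r * M :=
    (abs_real_inner_le_norm _ _).trans (mul_le_mul_of_nonneg_left ha (norm_nonneg _))
  have e1 : ‖2 * inner ℝ (q + t • b) b / r ^ 3‖ ≤ 2 * (‖q‖ + M) * M / l ^ 3 := by
    rw [norm_div, norm_mul, Real.norm_eq_abs, Real.norm_eq_abs, Real.norm_eq_abs,
      abs_of_pos (pow_pos hrpos 3), abs_two, mul_assoc]
    gcongr
  have e2 : ‖3 * ‖q + t • b‖ ^ 2 * inner ℝ (p + t • a) a / r ^ 5‖ ≤
      3 * (‖q‖ + M) ^ 2 * M / l ^ 4 := by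
    rw [norm_div, norm_mul, Real.norm_of_nonneg (by positivity), Real.norm_eq_abs,
      Real.norm_of_nonneg (by positivity)]
    calc
      _ ≤ 3 * (‖q‖ + M) ^ 2 * (r * M) / r ^ 5 := by gcongr
      _ = 3 * (‖q‖ + M) ^ 2 * M / r ^ 4 := by field_simp
      _ ≤ _ := by gcongr
  have e3 : ‖inner ℝ (p + t • a) a / r‖ ≤ M := by
    rw [norm_div, Real.norm_eq_abs, Real.norm_of_nonneg hrpos.le, div_le_iff₀ hrpos, mul_comm]
    exact h2
  exact (norm_add_le _ _).trans (add_le_add ((norm_sub_le _ _).trans (add_le_add e1 e2)) e3)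

namespace HasH2Derivs

variable {γ v w : ℝ → Plane}

theorem add_test (h : HasH2Derivs γ v w) {φ : ℝ → ℝ} (hφ : IsTestFunction φ) (e : Plane) (t : ℝ) :
    HasH2Derivs (fun x ↦ γ x + t • φ x • e) (fun x ↦ v x + t • deriv φ x • e)
      (fun x ↦ w x + t • deriv (deriv φ) x • e) := by
  have hη : HasH2Derivs (fun x ↦ t • φ x • e) (fun x ↦ t • deriv φ x • e)
      (fun x ↦ t • deriv (deriv φ) x • e) :=
    hasH2Derivs_of_hasDerivAt (fun x ↦ ((hφ.hasDerivAt x).smul_const e).const_smul t)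
      (fun x ↦ ((hφ.deriv.hasDerivAt x).smul_const e).const_smul t)
      ((hφ.deriv.deriv.continuous.smul continuous_const).const_smul t)
  refine ⟨fun x hx ↦ (h.hasDerivWithinAt x hx).add (hη.hasDerivWithinAt x hx), h.ac.add hη.ac, ?_,
    h.isL2.add hη.isL2⟩
  filter_upwards [h.ae_hasDerivAt, hη.ae_hasDerivAt] with x h1 h2 hx
  exact (h1 hx).add (h2 hx)

theorem sameBoundary_add_test (h : HasH2Derivs γ v w) {φ : ℝ → ℝ} (hφ : IsTestFunction φ)
    (e : Plane) (t : ℝ) : SameBoundary (fun x ↦ γ x + t • φ x • e) γ := by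
  intro x hx
  have hx1 : x ∈ Icc (0 : ℝ) 1 := by rcases hx with rfl | rfl <;> simp
  have hx2 : x ∉ Ioo (0 : ℝ) 1 := by rcases hx with rfl | rfl <;> simp
  rw [(h.add_test hφ e t).tangent_eq hx1, h.tangent_eq hx1]
  simp only [hφ.eq_zero_of_notMem hx2, hφ.deriv.eq_zero_of_notMem hx2]
  simp

theorem intervalIntegrable_energyDensity (h : HasH2Derivs γ v w)
    (h0 : ∀ x ∈ Icc (0 : ℝ) 1, v x ≠ 0) :
    IntervalIntegrable (fun x ↦ ‖w x‖ ^ 2 / ‖v x‖ ^ 3 + ‖v x‖) volume 0 1 := by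
  have hc : ContinuousOn v (uIcc 0 1) := by
    rw [uIcc_of_le zero_le_one]
    exact h.continuousOn
  rw [← uIcc_of_le zero_le_one] at h0
  simp only [div_eq_mul_inv]
  exact (h.intervalIntegrable_norm_sq.mul_continuousOn ((hc.norm.pow 3).inv₀ fun x hx ↦
    pow_ne_zero 3 (norm_ne_zero_iff.2 (h0 x hx)))).add hc.norm.intervalIntegrable

/-- The first variation of the elastic energy vanishes at a minimizer of constant speed `L`, for
variations `γ + t φ e`. Since `∫ (|γ''|² / |γ'|³ + |γ'|)` bounds the elastic energy from above and
agrees with it for constant speed, this simpler functional may be varied instead. -/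
theorem firstVariation_eq_zero (h : HasH2Derivs γ v w) {L : ℝ} (hL : 0 < L)
    (hv : ∀ x ∈ Icc (0 : ℝ) 1, ‖v x‖ = L)
    (hmin : ∀ γ' : ℝ → Plane, IsH2 γ' → IsRegularCurve γ' → SameBoundary γ' γ →
      elasticEnergy γ ≤ elasticEnergy γ') {φ : ℝ → ℝ} (hφ : IsTestFunction φ) (e : Plane) :
    IntervalIntegrable (fun x ↦ 2 * inner ℝ (w x) (deriv (deriv φ) x • e) / L ^ 3
        - 3 * ‖w x‖ ^ 2 * inner ℝ (v x) (deriv φ x • e) / L ^ 5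
        + inner ℝ (v x) (deriv φ x • e) / L) volume 0 1 ∧
    ∫ x in (0 : ℝ)..1, (2 * inner ℝ (w x) (deriv (deriv φ) x • e) / L ^ 3
        - 3 * ‖w x‖ ^ 2 * inner ℝ (v x) (deriv φ x • e) / L ^ 5
        + inner ℝ (v x) (deriv φ x • e) / L) = 0 := by
  obtain ⟨M₁, hM₁⟩ := hφ.deriv.hasCompactSupport.exists_bound_of_continuous hφ.deriv.continuous
  obtain ⟨M₂, hM₂⟩ :=
    hφ.deriv.deriv.hasCompactSupport.exists_bound_of_continuous hφ.deriv.deriv.continuous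
  set M := max M₁ M₂ * ‖e‖ with hM
  have ha (x : ℝ) : ‖deriv φ x • e‖ ≤ M := by
    rw [norm_smul]
    exact mul_le_mul_of_nonneg_right ((hM₁ x).trans (le_max_left _ _)) (norm_nonneg _)
  have hb (x : ℝ) : ‖deriv (deriv φ) x • e‖ ≤ M := by
    rw [norm_smul]
    exact mul_le_mul_of_nonneg_right ((hM₂ x).trans (le_max_right _ _)) (norm_nonneg _)
  have hM0 : 0 ≤ M := (norm_nonneg _).trans (ha 0)
  -- For `|t| < δ` the speed of the varied curve is at least `L / 2`.
  set δ := min 1 (L / (2 * (M + 1))) with hδ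
  have hδpos : 0 < δ := by positivity
  have hδ1 : δ ≤ 1 := min_le_left _ _
  have hspeed (x : ℝ) (hx : x ∈ Icc (0 : ℝ) 1) (t : ℝ) (ht : t ∈ Ioo (-δ) δ) :
      L / 2 ≤ ‖v x + t • deriv φ x • e‖ := by
    have h1 : ‖t • deriv φ x • e‖ ≤ L / 2 := by
      rw [norm_smul, Real.norm_eq_abs]
      calc
        |t| * ‖deriv φ x • e‖ ≤ L / (2 * (M + 1)) * (M + 1) :=
          mul_le_mul ((abs_lt.2 ht).le.trans (min_le_right _ _)) ((ha x).trans (by linarith))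
            (norm_nonneg _) (by positivity)
        _ = L / 2 := by field_simp
    have h2 := norm_sub_le (v x + t • deriv φ x • e) (t • deriv φ x • e)
    rw [add_sub_cancel_right, hv x hx] at h2
    linarith
  have hne (x : ℝ) (hx : x ∈ Icc (0 : ℝ) 1) (t : ℝ) (ht : t ∈ Ioo (-δ) δ) :
      v x + t • deriv φ x • e ≠ 0 :=
    norm_pos_iff.1 ((half_pos hL).trans_le (hspeed x hx t ht))
  set F : ℝ → ℝ → ℝ := fun t x ↦ ‖w x + t • deriv (deriv φ) x • e‖ ^ 2 /
    ‖v x + t • deriv φ x • e‖ ^ 3 + ‖v x + t • deriv φ x • e‖ with hF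
  set F' : ℝ → ℝ → ℝ := fun t x ↦
    2 * inner ℝ (w x + t • deriv (deriv φ) x • e) (deriv (deriv φ) x • e) /
        ‖v x + t • deriv φ x • e‖ ^ 3
      - 3 * ‖w x + t • deriv (deriv φ) x • e‖ ^ 2 *
        inner ℝ (v x + t • deriv φ x • e) (deriv φ x • e) / ‖v x + t • deriv φ x • e‖ ^ 5
      + inner ℝ (v x + t • deriv φ x • e) (deriv φ x • e) / ‖v x + t • deriv φ x • e‖ with hF'
  have hFint (t : ℝ) (ht : t ∈ Ioo (-δ) δ) : IntervalIntegrable (F t) volume 0 1 :=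
    (h.add_test hφ e t).intervalIntegrable_energyDensity fun x hx ↦ hne x hx t ht
  have hnhds : Ioo (-δ) δ ∈ 𝓝 (0 : ℝ) := Ioo_mem_nhds (by linarith) hδpos
  have h0mem : (0 : ℝ) ∈ Ioo (-δ) δ := mem_of_mem_nhds hnhds
  have hmeas : AEStronglyMeasurable (F' 0) (volume.restrict (uIoc 0 1)) := by
    have h0 := h.add_test hφ e 0
    have hw := h0.isL2.intervalIntegrable.aestronglyMeasurable_restrict_uIoc
    have hv := (isL2_of_continuousOn
      h0.continuousOn).intervalIntegrable.aestronglyMeasurable_restrict_uIoc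
    have hA : AEStronglyMeasurable (fun x ↦ deriv φ x • e) (volume.restrict (uIoc 0 1)) :=
      (hφ.deriv.continuous.smul continuous_const).aestronglyMeasurable
    have hB : AEStronglyMeasurable (fun x ↦ deriv (deriv φ) x • e) (volume.restrict (uIoc 0 1)) :=
      (hφ.deriv.deriv.continuous.smul continuous_const).aestronglyMeasurable
    exact ((((hw.inner hB (𝕜 := ℝ)).const_mul 2).div₀ (hv.norm.pow 3)).sub
      ((((hw.norm.pow 2).const_mul 3).mul (hv.inner hA (𝕜 := ℝ))).div₀ (hv.norm.pow 5))).add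
      ((hv.inner hA (𝕜 := ℝ)).div₀ hv.norm)
  have hbound : IntervalIntegrable (fun x ↦ 2 * (‖w x‖ + M) * M / (L / 2) ^ 3 +
      3 * (‖w x‖ + M) ^ 2 * M / (L / 2) ^ 4 + M) volume 0 1 := by
    have h1 := (h.isL2.intervalIntegrable.norm.const_mul
      (2 * M / (L / 2) ^ 3 + 6 * M ^ 2 / (L / 2) ^ 4)).add
      ((h.intervalIntegrable_norm_sq.const_mul (3 * M / (L / 2) ^ 4)).add
        (intervalIntegrable_const (c := 2 * M ^ 2 / (L / 2) ^ 3 + 3 * M ^ 3 / (L / 2) ^ 4 + M)))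
    refine h1.congr fun x _ ↦ ?_
    ring
  have hder := intervalIntegral.hasDerivAt_integral_of_dominated_loc_of_deriv_le (μ := volume)
    (F := F) (F' := F') (x₀ := 0) (a := 0) (b := 1) hnhds
    (eventually_of_mem hnhds fun t ht ↦ (hFint t ht).aestronglyMeasurable_restrict_uIoc)
    (hFint 0 h0mem) hmeas
    (.of_forall fun x hx t ht ↦ by
      rw [uIoc_of_le zero_le_one] at hx
      exact abs_energyDensity_deriv_le (half_pos hL) (hspeed x (Ioc_subset_Icc_self hx) t ht)
        (ha x) (hb x) ((abs_lt.2 ht).le.trans hδ1))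
    hbound
    (.of_forall fun x hx t ht ↦ by
      rw [uIoc_of_le zero_le_one] at hx
      exact hasDerivAt_energyDensity (hne x (Ioc_subset_Icc_self hx) t ht))
  have hreg (t : ℝ) (ht : t ∈ Ioo (-δ) δ) : IsRegularCurve (fun x ↦ γ x + t • φ x • e) :=
    (h.add_test hφ e t).isRegularCurve_iff.2 fun x hx ↦ hne x hx t ht
  have hregγ : IsRegularCurve γ := h.isRegularCurve_iff.2 fun x hx h0 ↦ by
    have := hv x hx
    rw [h0, norm_zero] at this
    exact hL.ne this
  have hlen : arcLength γ = L := by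
    rw [h.arcLength_eq, intervalIntegral.integral_congr (g := fun _ ↦ L) fun y hy ↦ by
      rw [uIcc_of_le zero_le_one] at hy
      exact hv y hy]
    simp
  have hF0 : ∫ x in (0 : ℝ)..1, F 0 x = elasticEnergy γ := by
    rw [h.elasticEnergy_eq_constSpeedEnergy hregγ (by rwa [hlen]), h.constSpeedEnergy_eq, hlen,
      ← intervalIntegral.integral_const_mul]
    have h1 : ∫ x in (0 : ℝ)..1, F 0 x = ∫ x in (0 : ℝ)..1, (1 / L ^ 3 * ‖w x‖ ^ 2 + L) := by
      refine intervalIntegral.integral_congr fun x hx ↦ ?_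
      rw [uIcc_of_le zero_le_one] at hx
      simp only [hF, zero_smul, add_zero, hv x hx]
      ring
    rw [h1, intervalIntegral.integral_add (h.intervalIntegrable_norm_sq.const_mul _)
      intervalIntegrable_const]
    simp
  have hlocmin : IsLocalMin (fun t ↦ ∫ x in (0 : ℝ)..1, F t x) 0 := by
    filter_upwards [hnhds] with t ht
    rw [hF0]
    exact (hmin _ (h.add_test hφ e t).isH2 (hreg t ht) (h.sameBoundary_add_test hφ e t)).trans
      ((h.add_test hφ e t).elasticEnergy_le (hreg t ht) (hFint t ht))
  have hEq : EqOn (F' 0) (fun x ↦ 2 * inner ℝ (w x) (deriv (deriv φ) x • e) / L ^ 3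
        - 3 * ‖w x‖ ^ 2 * inner ℝ (v x) (deriv φ x • e) / L ^ 5
        + inner ℝ (v x) (deriv φ x • e) / L) (uIcc 0 1) := fun x hx ↦ by
    rw [uIcc_of_le zero_le_one] at hx
    simp only [hF', zero_smul, add_zero, hv x hx]
  refine ⟨hder.1.congr (hEq.mono uIoc_subset_uIcc), ?_⟩
  rw [← intervalIntegral.integral_congr hEq]
  exact hlocmin.hasDerivAt_eq_zero hder.2

/-- The Euler–Lagrange equation, integrated once: in the sense of distributions,
`(2 / L³) γ''' = (1 / L - 3 |γ''|² / L⁵) γ' - c` for a constant vector `c`. -/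
theorem exists_isWeakDeriv_of_minimizer (h : HasH2Derivs γ v w) {L : ℝ} (hL : 0 < L)
    (hv : ∀ x ∈ Icc (0 : ℝ) 1, ‖v x‖ = L)
    (hmin : ∀ γ' : ℝ → Plane, IsH2 γ' → IsRegularCurve γ' → SameBoundary γ' γ →
      elasticEnergy γ ≤ elasticEnergy γ') :
    IntervalIntegrable (fun x ↦ (1 / L - 3 * ‖w x‖ ^ 2 / L ^ 5) • v x) volume 0 1 ∧
    ∃ c : Plane, IsWeakDeriv (fun x ↦ (2 / L ^ 3) • w x)
      (fun x ↦ (1 / L - 3 * ‖w x‖ ^ 2 / L ^ 5) • v x - c) := by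
  have hf : IntervalIntegrable (fun x ↦ (2 / L ^ 3) • w x) volume 0 1 :=
    h.isL2.intervalIntegrable.continuousOn_smul continuousOn_const
  have hg : IntervalIntegrable (fun x ↦ (1 / L - 3 * ‖w x‖ ^ 2 / L ^ 5) • v x) volume 0 1 := by
    have hc : ContinuousOn v (uIcc 0 1) := by
      rw [uIcc_of_le zero_le_one]
      exact h.continuousOn
    exact (intervalIntegrable_const.sub
      ((h.intervalIntegrable_norm_sq.const_mul 3).div_const _)).smul_continuousOn hc
  refine ⟨hg, exists_isWeakDeriv_sub_const hf hg fun φ hφ ↦ ?_⟩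
  have hfi := hφ.deriv.deriv.intervalIntegrable_smul hf
  have hgi := hφ.deriv.intervalIntegrable_smul hg
  rw [← intervalIntegral.integral_add hfi hgi]
  refine ext_inner_left ℝ fun e ↦ ?_
  rw [inner_zero_right]
  refine Eq.trans ?_ (h.firstVariation_eq_zero hL hv hmin hφ e).2
  refine ((innerSL ℝ e).intervalIntegral_comp_comm (hfi.add hgi)).symm.trans ?_
  refine intervalIntegral.integral_congr fun x _ ↦ ?_
  simp only [innerSL_apply_apply, inner_add_right, inner_smul_right,
    real_inner_comm e]
  ring

/-- The second derivative of a constant speed minimizer is continuously differentiable up to the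
boundary, and the integrated Euler–Lagrange equation holds pointwise. -/
theorem exists_hasDerivWithinAt_of_minimizer (h : HasH2Derivs γ v w) {L : ℝ} (hL : 0 < L)
    (hv : ∀ x ∈ Icc (0 : ℝ) 1, ‖v x‖ = L)
    (hmin : ∀ γ' : ℝ → Plane, IsH2 γ' → IsRegularCurve γ' → SameBoundary γ' γ →
      elasticEnergy γ ≤ elasticEnergy γ') :
    ∃ (u : ℝ → Plane) (c : Plane), ∀ x ∈ Icc (0 : ℝ) 1,
      HasDerivWithinAt v (u x) (Icc 0 1) x ∧
      HasDerivWithinAt u ((L ^ 3 / 2) • ((1 / L - 3 * ‖u x‖ ^ 2 / L ^ 5) • v x - c))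
        (Icc 0 1) x := by
  obtain ⟨hg, c, hc⟩ := h.exists_isWeakDeriv_of_minimizer hL hv hmin
  have hgc := hg.sub (intervalIntegrable_const (c := c))
  obtain ⟨C, hC⟩ := hc.exists_ae_eq
    (h.isL2.intervalIntegrable.continuousOn_smul continuousOn_const) hgc
  -- `u` is the absolutely continuous representative of the second derivative `w`.
  set u : ℝ → Plane := fun x ↦ (L ^ 3 / 2) •
    (C + ∫ t in (0 : ℝ)..x, ((1 / L - 3 * ‖w t‖ ^ 2 / L ^ 5) • v t - c)) with hu
  have hae : ∀ᵐ x, x ∈ Icc (0 : ℝ) 1 → w x = u x := by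
    refine ae_of_ae_Ioo ?_
    filter_upwards [hC] with x hx hm
    simp only [hu]
    rw [← hx hm, smul_smul]
    field_simp
    simp
  have huc : ContinuousOn u (Icc 0 1) := by
    have := (absolutelyContinuousOnInterval_integral hgc).continuousOn
    rw [uIcc_of_le zero_le_one] at this
    exact (continuousOn_const (c := L ^ 3 / 2)).smul (continuousOn_const.add this)
  have hae' {x : ℝ} (hx : x ∈ Icc (0 : ℝ) 1) : ∀ᵐ t, t ∈ uIoc 0 x → w t = u t := by
    filter_upwards [hae] with t ht htm
    rw [uIoc_of_le hx.1] at htm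
    exact ht ⟨htm.1.le, htm.2.trans hx.2⟩
  have hveq : EqOn v (fun x ↦ v 0 + ∫ t in (0 : ℝ)..x, u t) (Icc 0 1) := fun x hx ↦ by
    have hsub : uIcc 0 x ⊆ uIcc 0 1 := by
      rw [uIcc_of_le hx.1, uIcc_of_le zero_le_one]
      exact Icc_subset_Icc_right hx.2
    have h1 := (integral_eq_sub_of_ae_hasDerivAt (h.ac.mono hsub) (by
      filter_upwards [h.ae_hasDerivAt] with t ht htm
      have := hsub htm
      rw [uIcc_of_le zero_le_one] at this
      exact ht this)).2
    simp only
    rw [← intervalIntegral.integral_congr_ae (hae' hx), h1]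
    abel
  -- Replacing `w` by `u` makes the right-hand side continuous, and then `u` continuously
  -- differentiable.
  set G : ℝ → Plane := fun x ↦ (1 / L - 3 * ‖u x‖ ^ 2 / L ^ 5) • v x - c with hG
  have hGc : ContinuousOn G (Icc 0 1) :=
    ((continuousOn_const.sub (((huc.norm.pow 2).const_mul 3).div_const _)).smul
      h.continuousOn).sub continuousOn_const
  have hueq : EqOn u (fun x ↦ (L ^ 3 / 2) • (C + ∫ t in (0 : ℝ)..x, G t)) (Icc 0 1) :=
    fun x hx ↦ by
      have : ∫ t in (0 : ℝ)..x, ((1 / L - 3 * ‖w t‖ ^ 2 / L ^ 5) • v t - c) =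
          ∫ t in (0 : ℝ)..x, G t := by
        refine intervalIntegral.integral_congr_ae ?_
        filter_upwards [hae' hx] with t ht htm
        simp only [hG, ht htm]
      simp only [hu]
      rw [this]
  refine ⟨u, c, fun x hx ↦ ⟨?_, ?_⟩⟩
  · exact ((hasDerivWithinAt_integral_Icc huc hx).const_add (v 0)).congr hveq (hveq hx)
  · exact (((hasDerivWithinAt_integral_Icc hGc hx).const_add C).const_smul _).congr hueq (hueq hx)

end HasH2Derivs

/-! ### Smoothness and the equation for the curvature -/

theorem contDiffOn_succ_of_hasDerivWithinAt {E : Type*} [NormedAddCommGroup E] [NormedSpace ℝ E]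
    {f f' : ℝ → E} {n : ℕ} (hf : ∀ x ∈ Icc (0 : ℝ) 1, HasDerivWithinAt f (f' x) (Icc 0 1) x)
    (hf' : ContDiffOn ℝ n f' (Icc 0 1)) : ContDiffOn ℝ (n + 1 : ℕ) f (Icc 0 1) := by
  have hu : UniqueDiffOn ℝ (Icc (0 : ℝ) 1) := uniqueDiffOn_Icc zero_lt_one
  rw [Nat.cast_add, Nat.cast_one, contDiffOn_succ_iff_derivWithin hu]
  exact ⟨fun x hx ↦ (hf x hx).differentiableWithinAt, by simp,
    hf'.congr fun x hx ↦ (hf x hx).derivWithin (hu x hx)⟩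

/-- Bootstrapping: solutions of the integrated Euler–Lagrange system are smooth. -/
theorem contDiffOn_infty_of_system {γ v u : ℝ → Plane} {L : ℝ} {c : Plane}
    (hγ : ∀ x ∈ Icc (0 : ℝ) 1, HasDerivWithinAt γ (v x) (Icc 0 1) x)
    (hv : ∀ x ∈ Icc (0 : ℝ) 1, HasDerivWithinAt v (u x) (Icc 0 1) x)
    (hu : ∀ x ∈ Icc (0 : ℝ) 1, HasDerivWithinAt u
      ((L ^ 3 / 2) • ((1 / L - 3 * ‖u x‖ ^ 2 / L ^ 5) • v x - c)) (Icc 0 1) x) :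
    ContDiffOn ℝ ∞ γ (Icc 0 1) := by
  have key (n : ℕ) : ContDiffOn ℝ n v (Icc 0 1) ∧ ContDiffOn ℝ n u (Icc 0 1) := by
    induction n with
    | zero =>
      simp only [Nat.cast_zero, contDiffOn_zero]
      exact ⟨fun x hx ↦ (hv x hx).continuousWithinAt, fun x hx ↦ (hu x hx).continuousWithinAt⟩
    | succ n ih =>
      refine ⟨contDiffOn_succ_of_hasDerivWithinAt hv ih.2,
        contDiffOn_succ_of_hasDerivWithinAt hu ?_⟩
      exact (contDiffOn_const (c := L ^ 3 / 2)).smul (((contDiffOn_const.sub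
        ((contDiffOn_const.mul (ih.2.norm_sq ℝ)).div_const _)).smul ih.1).sub contDiffOn_const)
  refine contDiffOn_infty.2 fun n ↦ ?_
  exact (contDiffOn_succ_of_hasDerivWithinAt hγ (key n).1).of_le (by exact_mod_cast n.le_succ)

theorem hasDerivWithinAt_coord {f : ℝ → Plane} {f' : Plane} {s : Set ℝ} {x : ℝ}
    (hf : HasDerivWithinAt f f' s x) (i : Fin 2) :
    HasDerivWithinAt (fun x ↦ f x i) (f' i) s x :=
  (EuclideanSpace.proj (𝕜 := ℝ) i : Plane →L[ℝ] ℝ).hasFDerivAt.comp_hasDerivWithinAt x hf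

/-- For a constant speed solution of the integrated Euler–Lagrange system
`(2 / L³) γ''' = (1 / L - 3 |γ''|² / L⁵) γ' - c`, the component normal to the curve gives
`k' = -⟨c, Jγ'⟩ / 2` and the tangential one `⟨c, γ'⟩ = L (1 - k²)`; differentiating the former
yields the equation for the curvature. -/
theorem HasH2Derivs.curvature_equation {γ v w u : ℝ → Plane} (h : HasH2Derivs γ v w) {L : ℝ}
    (hL : 0 < L) {c : Plane} (hspeed : ∀ x ∈ Icc (0 : ℝ) 1, ‖v x‖ = L)
    (hv : ∀ x ∈ Icc (0 : ℝ) 1, HasDerivWithinAt v (u x) (Icc 0 1) x)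
    (hu : ∀ x ∈ Icc (0 : ℝ) 1, HasDerivWithinAt u
      ((L ^ 3 / 2) • ((1 / L - 3 * ‖u x‖ ^ 2 / L ^ 5) • v x - c)) (Icc 0 1) x)
    {x : ℝ} (hx : x ∈ Icc (0 : ℝ) 1) :
    2 * dS γ (dS γ (curvature γ)) x + curvature γ x ^ 3 - curvature γ x = 0 := by
  have hud : UniqueDiffOn ℝ (Icc (0 : ℝ) 1) := uniqueDiffOn_Icc zero_lt_one
  have hk (y : ℝ) (hy : y ∈ Icc (0 : ℝ) 1) :
      curvature γ y = (u y 1 * v y 0 - u y 0 * v y 1) / L ^ 3 := by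
    have h0 : v y ≠ 0 := norm_pos_iff.1 (hspeed y hy ▸ hL)
    rw [h.curvature_eq hy h0 (hv y hy), hspeed y hy, inner_plane]
    simp [quarterTurn]
    ring
  have hk' (y : ℝ) (hy : y ∈ Icc (0 : ℝ) 1) :
      dS γ (curvature γ) y = L⁻¹ * ((c 0 * v y 1 - c 1 * v y 0) / 2) := by
    have hd := ((((hasDerivWithinAt_coord (hu y hy) 1).mul (hasDerivWithinAt_coord (hv y hy) 0)).sub
      ((hasDerivWithinAt_coord (hu y hy) 0).mul
        (hasDerivWithinAt_coord (hv y hy) 1))).div_const (L ^ 3)).congr hk (hk y hy)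
    rw [dS, h.dX_eq hy, hspeed y hy, dX, hd.derivWithin (hud y hy), smul_eq_mul]
    congr 1
    simp only [PiLp.smul_apply, PiLp.sub_apply, smul_eq_mul]
    field_simp
    ring
  have hk'' : dS γ (dS γ (curvature γ)) x = L⁻¹ * (L⁻¹ * ((c 0 * u x 1 - c 1 * u x 0) / 2)) := by
    have hd := (((((hasDerivWithinAt_coord (hv x hx) 1).const_mul (c 0)).sub
      ((hasDerivWithinAt_coord (hv x hx) 0).const_mul (c 1))).div_const 2).const_mul L⁻¹).congr
        hk' (hk' x hx)
    rw [dS, h.dX_eq hx, hspeed x hx, dX, hd.derivWithin (hud x hx), smul_eq_mul]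
  -- The speed is constant, so its first two derivatives vanish.
  have e0 : v x 0 ^ 2 + v x 1 ^ 2 = L ^ 2 := by rw [← norm_sq_plane, hspeed x hx]
  have hs1 (y : ℝ) (hy : y ∈ Icc (0 : ℝ) 1) : v y 0 * u y 0 + v y 1 * u y 1 = 0 := by
    rw [← inner_plane, inner_eq_zero_of_norm_eq hspeed hy (hv y hy)]
  have e1 := hs1 x hx
  have e2 : (u x 0 * u x 0 + v x 0 * ((L ^ 3 / 2) * ((1 / L - 3 * (u x 0 ^ 2 + u x 1 ^ 2) / L ^ 5)
      * v x 0 - c 0))) + (u x 1 * u x 1 + v x 1 * ((L ^ 3 / 2) *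
      ((1 / L - 3 * (u x 0 ^ 2 + u x 1 ^ 2) / L ^ 5) * v x 1 - c 1))) = 0 := by
    have hd := ((hasDerivWithinAt_coord (hv x hx) 0).mul (hasDerivWithinAt_coord (hu x hx) 0)).add
      ((hasDerivWithinAt_coord (hv x hx) 1).mul (hasDerivWithinAt_coord (hu x hx) 1))
    have := (hud x hx).eq_deriv _ hd ((hasDerivWithinAt_const x (Icc 0 1) (0 : ℝ)).congr hs1 e1)
    simpa only [norm_sq_plane, PiLp.smul_apply, PiLp.sub_apply, smul_eq_mul] using this
  rw [hk'', hk x hx]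
  generalize u x 0 = u0 at *
  generalize u x 1 = u1 at *
  generalize v x 0 = v0 at *
  generalize v x 1 = v1 at *
  generalize c 0 = c0 at *
  generalize c 1 = c1 at *
  have hu0 : L ^ 2 * u0 = -(u1 * v0 - u0 * v1) * v1 := by linear_combination (-u0) * e0 + v0 * e1
  have hu1 : L ^ 2 * u1 = (u1 * v0 - u0 * v1) * v0 := by linear_combination (-u1) * e0 + v1 * e1
  have hsq : L ^ 2 * (u0 ^ 2 + u1 ^ 2) = (u1 * v0 - u0 * v1) ^ 2 := by
    linear_combination (-(u0 ^ 2 + u1 ^ 2)) * e0 + (v0 * u0 + v1 * u1) * e1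
  have hcv : L ^ 5 * (c0 * v0 + c1 * v1) = L ^ 6 - L ^ 2 * (u0 ^ 2 + u1 ^ 2) := by
    field_simp at e2
    linear_combination (-1) * e2 + (L ^ 4 - 3 * (u0 ^ 2 + u1 ^ 2)) * e0
  have hcross : L ^ 2 * (c0 * u1 - c1 * u0) = (u1 * v0 - u0 * v1) * (c0 * v0 + c1 * v1) := by
    linear_combination c0 * hu1 - c1 * hu0
  have hfin : L ^ 7 * (c0 * u1 - c1 * u0) + (u1 * v0 - u0 * v1) ^ 3
      - (u1 * v0 - u0 * v1) * L ^ 6 = 0 := by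
    linear_combination L ^ 5 * hcross + (u1 * v0 - u0 * v1) * hcv - (u1 * v0 - u0 * v1) * hsq
  calc
    _ = (L ^ 7 * (c0 * u1 - c1 * u0) + (u1 * v0 - u0 * v1) ^ 3
        - (u1 * v0 - u0 * v1) * L ^ 6) / L ^ 9 := by field_simp
    _ = 0 := by rw [hfin, zero_div]

end ElasticNetwork

open ElasticNetwork
theorem mainTheorem10 (Γ : ThreeNetwork) (hΓ : Γ.IsMinimizer)
    (i : Fin 3) (hi : IsRegularCurve (Γ.curve i)) :
    (∀ γ : ℝ → Plane, IsH2 γ → IsRegularCurve γ → SameBoundary γ (Γ.curve i) →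
      elasticEnergy (Γ.curve i) ≤ elasticEnergy γ) ∧
    ContDiffOn ℝ ∞ (Γ.curve i) (Icc 0 1) ∧
    ∀ x ∈ Ioo (0 : ℝ) 1,
      2 * dS (Γ.curve i) (dS (Γ.curve i) (curvature (Γ.curve i))) x
        + curvature (Γ.curve i) x ^ 3 - curvature (Γ.curve i) x = 0 := by
  have hmin (γ : ℝ → Plane) (hγ : IsH2 γ) (hreg : IsRegularCurve γ)
      (hbd : SameBoundary γ (Γ.curve i)) : elasticEnergy (Γ.curve i) ≤ elasticEnergy γ :=
    hΓ.elasticEnergy_le hi hγ hreg hbd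
  obtain ⟨v, w, h⟩ := (Γ.isH2 i).exists_hasH2Derivs
  have hL := h.arcLength_pos hi
  have hspeed (x : ℝ) (hx : x ∈ Icc (0 : ℝ) 1) : ‖v x‖ = arcLength (Γ.curve i) := by
    rw [← h.dX_eq hx, Γ.const_speed i hi x hx]
  obtain ⟨u, c, hsys⟩ := h.exists_hasDerivWithinAt_of_minimizer hL hspeed hmin
  exact ⟨hmin, contDiffOn_infty_of_system h.hasDerivWithinAt (fun x hx ↦ (hsys x hx).1)
    fun x hx ↦ (hsys x hx).2, fun x hx ↦ h.curvature_equation hL hspeed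
      (fun y hy ↦ (hsys y hy).1) (fun y hy ↦ (hsys y hy).2) (Ioo_subset_Icc_self hx)⟩
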